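/- Let $(\Omega,\mathbb P)$ be a probability space carrying a family $\{\Xi_l\}_{l\in J}$ of independent standard complex Gaussian random variables (density $\frac1\pi e^{-|z|^2}$ on $\mathbb C$). A Gaussian entire function (G.E.F.) is a random function which almost surely satisfies, for all $z\in\mathbb C$, $$f(z)=\sum_{k\ge 0}\xi_k\frac{z^k}{\sqrt{k!}},$$ where $\xi_0,\xi_1,\dots$ are independent standard complex Gaussian random variables, each of which is a (possibly infinite) complex linear combination of the $\Xi_l$ with square summable coefficients, convergent in $L^2(\mathbb P)$. For $g\colon\mathbb C\to\mathbb C$ and $w\in\mathbb C$ put $$T_wg(z)=g(w+z)\,e^{-z\overline w}\,e^{-\frac12|w|^2}.$$ Theorem (almost independence). For every $N>0$ there exists $A=A(N)>0$, depending only on $N$, such that the following holds. Let $(\Omega,\mathbb P)$ and $\{\Xi_l\}$ be as above, let $f$ be a G.E.F., and suppose that the family $\{\Xi_l\}$ is so large that infinitely many of the $\Xi_l$ are independent of $f$. Then for every $r>1$ and every (finite or infinite) family of points $w_j\in\mathbb C$ satisfying $|w_i-w_j|\ge Ar$ for $i\ne j$, one can write $$T_{w_j}f=f_j+h_j\qquad\text{for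 all } j,$$ where the $f_j$ are mutually independent G.E.F. and the $h_j$ are random (almost surely entire) analytic functions such that, for each $j$, $$\mathbb P\Bigl\{\max_{|z|\le r}|h_j(z)|>e^{-Nr^2}\Bigr\}\le 2\exp\Bigl\{-\tfrac12\exp\{Nr^2\}\Bigr\}.$$ -/

import Mathlib

open MeasureTheory ProbabilityTheory Filter Topology
open scoped ENNReal ComplexConjugate

noncomputable section

namespace GaussianEntire

/-- The standard complex Gaussian law: density `π⁻¹ exp (-|z|²)` with respect to area on `ℂ`. -/
def stdComplexGaussian : Measure ℂ :=
  (volume : Measure ℂ).withDensity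
    (fun z => ENNReal.ofReal (Real.pi⁻¹ * Real.exp (-‖z‖ ^ 2)))

variable {Ω J : Type*} [MeasurableSpace Ω]

/-- `Ξ` is a family of independent standard complex Gaussian random variables on `(Ω, P)`. -/
structure IsStdGaussianFamily (P : Measure Ω) (Ξ : J → Ω → ℂ) : Prop where
  hasLaw : ∀ j, HasLaw (Ξ j) stdComplexGaussian P
  indep : iIndepFun Ξ P

/-- `ξ` is a (possibly infinite) complex linear combination of the `Ξ j` with square summable
coefficients, the series being (unconditionally) convergent in `L²(P)`. -/
def InGaussianSpace (P : Measure Ω) (Ξ : J → Ω → ℂ) (ξ : Ω → ℂ) : Prop :=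
  AEMeasurable ξ P ∧ ∃ a : J → ℂ, Summable (fun j => ‖a j‖ ^ 2) ∧
    Tendsto (fun s : Finset J => eLpNorm (fun ω => ξ ω - ∑ j ∈ s, a j * Ξ j ω) 2 P)
      atTop (𝓝 0)

/-- `f` is a Gaussian entire function over the Gaussian family `Ξ`: almost surely
`f(z) = ∑ ξ_k z^k / √(k!)` for all `z`, where the `ξ_k` are independent standard complex
Gaussian random variables, each one a square summable linear combination of the `Ξ j`. -/
def IsGEF (P : Measure Ω) (Ξ : J → Ω → ℂ) (f : Ω → ℂ → ℂ) : Prop :=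
  ∃ ξ : ℕ → Ω → ℂ,
    (∀ k, InGaussianSpace P Ξ (ξ k)) ∧
    IsStdGaussianFamily P ξ ∧
    ∀ᵐ ω ∂P, ∀ z : ℂ,
      HasSum (fun k : ℕ => ξ k ω * (z ^ k / (Real.sqrt (k.factorial : ℝ) : ℂ))) (f ω z)

/-- `h` is a random analytic (entire) function: its values are random variables, and almost
surely it is analytic in the whole plane. -/
def IsRandomEntire (P : Measure Ω) (h : Ω → ℂ → ℂ) : Prop :=
  (∀ z, AEMeasurable (fun ω => h ω z) P) ∧ ∀ᵐ ω ∂P, Differentiable ℂ (h ω)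

/-- The operator `(T_w g)(z) = g(w + z) exp(-z w̄) exp(-|w|²/2)`. -/
def shiftOp (w : ℂ) (g : ℂ → ℂ) (z : ℂ) : ℂ :=
  g (w + z) * Complex.exp (-(z * conj w)) * (Real.exp (-(‖w‖ ^ 2 / 2)) : ℂ)

end GaussianEntire

end

noncomputable section

namespace GaussianEntire

/-! In the closed complex span of the $\Xi_l$ in $L^2$ every unit vector is a standard complex
Gaussian, and orthonormal vectors are independent (`IsStdGaussianFamily.of_orthonormal`). So the
theorem reduces to Hilbert space geometry. The function $f$ corresponds to coherent vectors with
kernel $e^{z\bar z'}$; the shift $T_w$ preserves this kernel, hence the coefficients of each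
$T_{w_j}f$ are again orthonormal (`orthonormal_shiftedCoeff`).

Coefficients of $T_{w_i}f$ and $T_{w_j}f$ of index at most $B=\rho^2$, a multiple of $r^2$, are
nearly orthogonal when $w_i,w_j$ are far apart: the covariance of the two shifts has Gaussian decay
in the distance, and Cauchy's estimate on circles of radius $\rho$ carries this over to coefficients
(`norm_inner_shiftedCoeff_shiftedCoeff_le`). Coefficients past $B$ hardly matter on $|z|\le r$, so
they are replaced by distinct $\Xi_l$ independent of $f$, which are exactly orthogonal to everything
else. The resulting family over $I\times\mathbb N$ has off-diagonal row sums at most a small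
$\sigma$ (`sum_norm_inner_truncatedCoeff_le`), so Gram–Schmidt moves each vector by at most
$4\sigma$ (`exists_orthonormal_near`). Row $j$ of the orthonormal family gives the coefficients of
$f_j$.

The coefficients of $h_j$ then have norm at most $4\sigma$ up to $B$ and at most $2$ past it;
weighted at radius $r$ they sum to at most $D=e^{-3Nr^2/2}$ (`error_sum_le`). A subgaussian bound
that needs no independence among them (`measure_exists_lt_sum_norm_le`), at level $tD$ with
$t=e^{Nr^2/2}$, gives the stated probability. -/

/-! ### The standard complex Gaussian law: moments and characteristic function. -/

lemma lintegral_stdComplexGaussian (g : ℂ → ℝ≥0∞) :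
    ∫⁻ z, g z ∂stdComplexGaussian =
      ∫⁻ z : ℂ, ENNReal.ofReal (Real.pi⁻¹ * Real.exp (-‖z‖ ^ 2)) * g z := by
  unfold stdComplexGaussian
  rw [lintegral_withDensity_eq_lintegral_mul_non_measurable]
  · rfl
  · fun_prop
  · exact ae_of_all _ fun _ => ENNReal.ofReal_lt_top

lemma integral_stdComplexGaussian {E : Type*} [NormedAddCommGroup E] [NormedSpace ℝ E]
    (g : ℂ → E) :
    ∫ z, g z ∂stdComplexGaussian = ∫ z : ℂ, (Real.pi⁻¹ * Real.exp (-‖z‖ ^ 2)) • g z := by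
  unfold stdComplexGaussian
  rw [integral_withDensity_eq_integral_toReal_smul]
  · refine integral_congr_ae (ae_of_all _ fun z => ?_)
    simp only
    rw [ENNReal.toReal_ofReal (by positivity)]
  · fun_prop
  · exact ae_of_all _ fun _ => ENNReal.ofReal_lt_top

lemma integrable_exp_neg_mul_sq_norm {b : ℝ} (hb : 0 < b) :
    Integrable fun z : ℂ => Real.exp (-b * ‖z‖ ^ 2) := by
  -- A nonintegrable function has integral 0 by default, so a positive value of the integral forces
  -- integrability.
  by_contra h
  have h1 := GaussianFourier.integral_rexp_neg_mul_sq_norm (V := ℂ) hb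
  rw [integral_undef h] at h1
  have : 0 < (Real.pi / b) ^ ((Module.finrank ℝ ℂ : ℝ) / 2) := by positivity
  linarith

lemma integral_exp_neg_mul_sq_norm {b : ℝ} (hb : 0 < b) :
    ∫ z : ℂ, Real.exp (-b * ‖z‖ ^ 2) = Real.pi / b := by
  rw [GaussianFourier.integral_rexp_neg_mul_sq_norm (V := ℂ) hb]
  simp

lemma lintegral_exp_neg_mul_sq_norm {b : ℝ} (hb : 0 < b) :
    ∫⁻ z : ℂ, ENNReal.ofReal (Real.pi⁻¹ * Real.exp (-b * ‖z‖ ^ 2)) = ENNReal.ofReal b⁻¹ := by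
  rw [← ofReal_integral_eq_lintegral_ofReal]
  · rw [integral_const_mul, integral_exp_neg_mul_sq_norm hb]
    congr 1
    field_simp
  · exact (integrable_exp_neg_mul_sq_norm hb).const_mul _
  · exact ae_of_all _ fun _ => by positivity

instance isProbabilityMeasure_stdComplexGaussian : IsProbabilityMeasure stdComplexGaussian := by
  constructor
  have h := lintegral_stdComplexGaussian (fun _ => 1)
  have h2 := lintegral_exp_neg_mul_sq_norm one_pos
  simp only [lintegral_const, one_mul, mul_one, neg_mul, inv_one, ENNReal.ofReal_one] at h h2
  rw [h, h2]

lemma lintegral_exp_half_sq_norm_stdComplexGaussian :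
    ∫⁻ z, ENNReal.ofReal (Real.exp (‖z‖ ^ 2 / 2)) ∂stdComplexGaussian = 2 := by
  have h2 := lintegral_exp_neg_mul_sq_norm (b := 1 / 2) (by norm_num)
  rw [lintegral_stdComplexGaussian]
  norm_num at h2
  rw [← h2]
  refine lintegral_congr fun z => ?_
  rw [← ENNReal.ofReal_mul (by positivity), mul_assoc, ← Real.exp_add]
  congr 3
  ring

lemma charFun_stdComplexGaussian (t : ℂ) :
    charFun stdComplexGaussian t = Complex.exp (-(‖t‖ ^ 2 / 4 : ℝ)) := by
  rw [charFun_apply, integral_stdComplexGaussian]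
  have h := GaussianFourier.integral_cexp_neg_mul_sq_norm_add (V := ℂ) (b := 1)
    (by simp) Complex.I t
  have h3 : ∀ v : ℂ, (Real.pi⁻¹ * Real.exp (-‖v‖ ^ 2)) •
      Complex.exp ((inner ℝ v t : ℝ) * Complex.I) =
      (Real.pi : ℂ)⁻¹ * Complex.exp (-1 * (‖v‖ : ℂ) ^ 2 + Complex.I * (inner ℝ t v : ℝ)) := by
    intro v
    rw [Complex.real_smul, Complex.exp_add, real_inner_comm]
    push_cast
    ring_nf
  simp_rw [h3]
  rw [integral_const_mul, h]
  have : (Real.pi : ℂ) ≠ 0 := by exact_mod_cast Real.pi_ne_zero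
  simp only [div_one, Complex.finrank_real_complex, Complex.I_sq]
  norm_num
  field_simp

lemma integral_id_stdComplexGaussian : ∫ z, z ∂stdComplexGaussian = 0 := by
  rw [integral_stdComplexGaussian]
  have h := integral_neg_eq_self
    (fun z : ℂ => (Real.pi⁻¹ * Real.exp (-‖z‖ ^ 2)) • z) volume
  simp only [norm_neg, smul_neg, integral_neg] at h
  exact self_eq_neg.mp h.symm

lemma lintegral_sq_norm_stdComplexGaussian :
    ∫⁻ z, ENNReal.ofReal (‖z‖ ^ 2) ∂stdComplexGaussian = 1 := by
  have h := Complex.integral_rpow_mul_exp_neg_rpow (p := 2) (q := 2) (by norm_num) (by norm_num)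
  norm_num at h
  have hi : Integrable fun z : ℂ => ‖z‖ ^ 2 * Real.exp (-‖z‖ ^ 2) := by
    by_contra hc
    rw [integral_undef hc] at h
    exact Real.pi_ne_zero h.symm
  rw [lintegral_stdComplexGaussian]
  have h4 : ∀ z : ℂ, ENNReal.ofReal (Real.pi⁻¹ * Real.exp (-‖z‖ ^ 2)) * ENNReal.ofReal (‖z‖ ^ 2)
      = ENNReal.ofReal (Real.pi⁻¹ * (‖z‖ ^ 2 * Real.exp (-‖z‖ ^ 2))) := by
    intro z
    rw [← ENNReal.ofReal_mul (by positivity)]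
    congr 1
    ring
  simp_rw [h4]
  rw [← ofReal_integral_eq_lintegral_ofReal (hi.const_mul _) (ae_of_all _ fun _ => by positivity),
    integral_const_mul, h, inv_mul_cancel₀ Real.pi_ne_zero, ENNReal.ofReal_one]

lemma eLpNorm_id_stdComplexGaussian : eLpNorm (fun z : ℂ => z) 2 stdComplexGaussian = 1 := by
  rw [eLpNorm_eq_lintegral_rpow_enorm_toReal (by norm_num) (by norm_num)]
  have h := lintegral_sq_norm_stdComplexGaussian
  have h4 : ∀ z : ℂ, ‖z‖ₑ ^ (2 : ℝ≥0∞).toReal = ENNReal.ofReal (‖z‖ ^ 2) := by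
    intro z
    rw [ENNReal.ofReal_pow (norm_nonneg _), ofReal_norm]
    simp
  simp_rw [h4]
  rw [h]
  simp

/-- Pythagoras for a finite combination of orthonormal vectors. -/
lemma norm_sq_sum_smul_of_orthonormal {E ι : Type*} [NormedAddCommGroup E] [InnerProductSpace ℂ E]
    {e : ι → E} (he : Orthonormal ℂ e) (c : ι → ℂ) (s : Finset ι) :
    ‖∑ i ∈ s, c i • e i‖ ^ 2 = ∑ i ∈ s, ‖c i‖ ^ 2 := by
  rw [@norm_sq_eq_re_inner ℂ, he.inner_sum]
  simp only [← Complex.normSq_eq_conj_mul_self, Complex.normSq_eq_norm_sq]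
  rw [map_sum]
  exact Finset.sum_congr rfl fun i _ => RCLike.ofReal_re _

/-! ### The Gaussian Hilbert space, where orthonormal means independent. -/

section

variable {Ω J : Type*} [MeasurableSpace Ω] {P : Measure Ω} {Ξ : J → Ω → ℂ}

lemma eLpNorm_of_hasLaw {X : Ω → ℂ} (hX : HasLaw X stdComplexGaussian P) :
    eLpNorm X 2 P = 1 := by
  rw [← eLpNorm_id_stdComplexGaussian, ← hX.map_eq, eLpNorm_map_measure (by fun_prop)
    hX.aemeasurable]
  rfl

lemma memLp_of_hasLaw {X : Ω → ℂ} (hX : HasLaw X stdComplexGaussian P) : MemLp X 2 P :=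
  ⟨hX.aemeasurable.aestronglyMeasurable, by rw [eLpNorm_of_hasLaw hX]; simp⟩

lemma integral_of_hasLaw {X : Ω → ℂ} (hX : HasLaw X stdComplexGaussian P) :
    ∫ ω, X ω ∂P = 0 := by
  rw [hX.integral_eq, integral_id_stdComplexGaussian]

/-- A standard complex Gaussian is orthogonal to every square integrable variable that is
independent of it. -/
lemma inner_toLp_eq_zero_of_indepFun {X Y : Ω → ℂ} (hX : HasLaw X stdComplexGaussian P)
    (hY : MemLp Y 2 P) (hXY : IndepFun X Y P) :
    inner ℂ ((memLp_of_hasLaw hX).toLp X) (hY.toLp Y) = 0 := by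
  rw [L2.inner_def]
  have h1 : (fun ω => inner ℂ ((memLp_of_hasLaw hX).toLp X ω) (hY.toLp Y ω)) =ᵐ[P]
      fun ω => conj (X ω) * Y ω := by
    filter_upwards [(memLp_of_hasLaw hX).coeFn_toLp, hY.coeFn_toLp] with ω h1 h2
    rw [h1, h2, RCLike.inner_apply, mul_comm]
  rw [integral_congr_ae h1]
  have h2 : IndepFun (fun ω => conj (X ω)) Y P :=
    hXY.comp (φ := fun z => conj z) (ψ := id) (by fun_prop) measurable_id
  have h3 : AEStronglyMeasurable (fun ω => conj (X ω)) P :=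
    (Complex.continuous_conj.comp_aestronglyMeasurable (memLp_of_hasLaw hX).1)
  rw [h2.integral_fun_mul_eq_mul_integral h3 hY.1, integral_conj, integral_of_hasLaw hX]
  simp

namespace IsStdGaussianFamily

/-- The members of a standard Gaussian family as vectors of `L²`. -/
def vec (h : IsStdGaussianFamily P Ξ) (j : J) : Lp ℂ 2 P := (memLp_of_hasLaw (h.hasLaw j)).toLp (Ξ j)

/-- The complex Gaussian Hilbert space generated by a standard Gaussian family. -/
def space (h : IsStdGaussianFamily P Ξ) : Submodule ℂ (Lp ℂ 2 P) :=
  (Submodule.span ℂ (Set.range h.vec)).topologicalClosure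

lemma coeFn_vec (h : IsStdGaussianFamily P Ξ) (j : J) : h.vec j =ᵐ[P] Ξ j :=
  (memLp_of_hasLaw (h.hasLaw j)).coeFn_toLp

lemma vec_mem_space (h : IsStdGaussianFamily P Ξ) (j : J) : h.vec j ∈ h.space :=
  Submodule.le_topologicalClosure _ (Submodule.subset_span ⟨j, rfl⟩)

lemma isClosed_space (h : IsStdGaussianFamily P Ξ) : IsClosed (h.space : Set (Lp ℂ 2 P)) :=
  Submodule.isClosed_topologicalClosure _

lemma orthonormal_vec (h : IsStdGaussianFamily P Ξ) : Orthonormal ℂ h.vec := by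
  refine ⟨fun j => ?_, fun i j hij => ?_⟩
  · rw [vec, Lp.norm_toLp, eLpNorm_of_hasLaw (h.hasLaw j)]
    simp
  · exact inner_toLp_eq_zero_of_indepFun (h.hasLaw i) _ (h.indep.indepFun hij)

end IsStdGaussianFamily

lemma norm_cexp_I_sub_le (a b : ℝ) :
    ‖Complex.exp (a * Complex.I) - Complex.exp (b * Complex.I)‖ ≤ |a - b| := by
  have h : Complex.exp (a * Complex.I) - Complex.exp (b * Complex.I) =
      Complex.exp (b * Complex.I) * (Complex.exp (Complex.I * ((a - b : ℝ) : ℂ)) - 1) := by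
    rw [mul_sub, ← Complex.exp_add]
    push_cast
    ring_nf
  rw [h, norm_mul, Complex.norm_exp_ofReal_mul_I, one_mul]
  exact Real.norm_exp_I_mul_ofReal_sub_one_le

lemma integrable_cexp_re_mul_I [IsProbabilityMeasure P] {X : Ω → ℂ} (hX : AEStronglyMeasurable X P) :
    Integrable (fun ω => Complex.exp ((X ω).re * Complex.I)) P := by
  refine Integrable.of_bound (C := 1) ?_ (ae_of_all _ fun ω => ?_)
  · have : Continuous fun z : ℂ => Complex.exp (z.re * Complex.I) := by fun_prop
    exact this.comp_aestronglyMeasurable hX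
  · rw [Complex.norm_exp_ofReal_mul_I]

/-- The map is 1-Lipschitz, because $|e^{ia}-e^{ib}|\le|a-b|$ and the $L^1$ norm is at most the
$L^2$ norm under a probability measure. -/
lemma continuous_integral_cexp_re [IsProbabilityMeasure P] :
    Continuous fun x : Lp ℂ 2 P => ∫ ω, Complex.exp ((x ω).re * Complex.I) ∂P := by
  refine LipschitzWith.continuous (K := 1) (LipschitzWith.of_dist_le_mul fun x y => ?_)
  rw [NNReal.coe_one, one_mul, dist_eq_norm, dist_eq_norm, ← integral_sub
    (integrable_cexp_re_mul_I (Lp.aestronglyMeasurable x))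
    (integrable_cexp_re_mul_I (Lp.aestronglyMeasurable y))]
  have hm : MemLp (⇑(x - y)) 1 P := (Lp.memLp (x - y)).mono_exponent (by norm_num)
  calc _ ≤ ∫ ω, ‖(x - y) ω‖ ∂P := by
        refine norm_integral_le_of_norm_le (hm.integrable le_rfl).norm ?_
        filter_upwards [Lp.coeFn_sub x y] with ω hω
        rw [hω]
        refine (norm_cexp_I_sub_le _ _).trans ?_
        rw [← Complex.sub_re]
        exact Complex.abs_re_le_norm _
    _ = (eLpNorm (⇑(x - y)) 1 P).toReal := by
        rw [eLpNorm_one_eq_lintegral_enorm, integral_norm_eq_lintegral_enorm hm.1]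
    _ ≤ (eLpNorm (⇑(x - y)) 2 P).toReal := by
        refine ENNReal.toReal_mono (Lp.eLpNorm_ne_top _) ?_
        exact eLpNorm_le_eLpNorm_of_exponent_le (by norm_num) hm.1
    _ = ‖x - y‖ := (Lp.norm_def _).symm

lemma charFun_map_eq_integral {X : Ω → ℂ} (hX : AEMeasurable X P) (t : ℂ) :
    charFun (P.map X) t = ∫ ω, Complex.exp ((conj t * X ω).re * Complex.I) ∂P := by
  rw [charFun_apply, integral_map hX (by fun_prop)]
  refine integral_congr_ae (ae_of_all _ fun ω => ?_)
  simp only [Complex.inner, mul_comm, Complex.mul_re, Complex.conj_re, Complex.conj_im]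
  congr 3
  ring

namespace IsStdGaussianFamily

lemma integral_cexp_re_of_mem_span (h : IsStdGaussianFamily P Ξ) {x : Lp ℂ 2 P}
    (hx : x ∈ Submodule.span ℂ (Set.range h.vec)) :
    ∫ ω, Complex.exp ((x ω).re * Complex.I) ∂P = Complex.exp (-(‖x‖ ^ 2 / 4 : ℝ)) := by
  rw [Finsupp.mem_span_range_iff_exists_finsupp] at hx
  obtain ⟨c, rfl⟩ := hx
  rw [Finsupp.sum]
  have hnorm := norm_sq_sum_smul_of_orthonormal h.orthonormal_vec c c.support
  have hmeas : ∀ j, AEMeasurable (fun ω => c j * Ξ j ω) P := fun j =>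
    (h.hasLaw j).aemeasurable.const_mul _
  have hae : ⇑(∑ j ∈ c.support, c j • h.vec j) =ᵐ[P]
      fun ω => ∑ j ∈ c.support, c j * Ξ j ω := by
    refine (Lp.coeFn_finsetSum _ _).trans ?_
    have : ∀ᵐ ω ∂P, ∀ j ∈ c.support, (c j • h.vec j) ω = c j * Ξ j ω := by
      rw [Filter.eventually_all_finset]
      intro j _
      filter_upwards [Lp.coeFn_smul (c j) (h.vec j), h.coeFn_vec j] with ω h1 h2
      rw [h1, Pi.smul_apply, h2, smul_eq_mul]
    filter_upwards [this] with ω hω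
    rw [Finset.sum_apply]
    exact Finset.sum_congr rfl hω
  have hind : iIndepFun (fun j ω => c j * Ξ j ω) P :=
    h.indep.comp (fun j z => c j * z) (fun j => by fun_prop)
  have hcf := (hind.restrict c.support).charFun_map_fun_finsetSum_eq_prod (fun j _ => hmeas j)
  have hcf1 := congrFun hcf 1
  rw [charFun_map_eq_integral (Finset.aemeasurable_fun_sum _ fun j _ => hmeas j)] at hcf1
  simp only [map_one, one_mul] at hcf1
  have h5 : ∀ j, charFun (P.map (fun ω => c j * Ξ j ω)) 1 =
      Complex.exp (-(‖c j‖ ^ 2 / 4 : ℝ)) := by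
    intro j
    rw [charFun_map_eq_integral (hmeas j), ← Complex.norm_conj, ← charFun_stdComplexGaussian,
      ← (h.hasLaw j).map_eq, charFun_map_eq_integral (h.hasLaw j).aemeasurable]
    simp
  refine (integral_congr_ae (hae.fun_comp fun z => Complex.exp (z.re * Complex.I))).trans ?_
  refine hcf1.trans ?_
  rw [ Finset.prod_apply, hnorm]
  simp_rw [h5]
  rw [← Complex.exp_sum]
  congr 1
  push_cast
  rw [Finset.sum_neg_distrib, Finset.sum_div]

/-- Both sides are continuous in `x`, so the identity passes from the span to its closure. It is the
characteristic function at 1 only; as the space is complex, replacing `x` by $\bar t x$ recovers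
every $t$. -/
lemma integral_cexp_re [IsProbabilityMeasure P] (h : IsStdGaussianFamily P Ξ) {x : Lp ℂ 2 P} (hx : x ∈ h.space) :
    ∫ ω, Complex.exp ((x ω).re * Complex.I) ∂P = Complex.exp (-(‖x‖ ^ 2 / 4 : ℝ)) := by
  have hclosed : IsClosed {x : Lp ℂ 2 P | ∫ ω, Complex.exp ((x ω).re * Complex.I) ∂P =
      Complex.exp (-(‖x‖ ^ 2 / 4 : ℝ))} :=
    isClosed_eq continuous_integral_cexp_re (by fun_prop)
  exact closure_minimal (fun y hy => h.integral_cexp_re_of_mem_span hy) hclosed hx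

end IsStdGaussianFamily

lemma sum_conj_smul_coeFn {ι : Type*} [Fintype ι] (e : ι → Lp ℂ 2 P) (t : ι → ℂ) :
    ⇑(∑ i, conj (t i) • e i) =ᵐ[P] fun ω => ∑ i, conj (t i) * e i ω := by
  refine (Lp.coeFn_finsetSum _ _).trans ?_
  have : ∀ᵐ ω ∂P, ∀ i, (conj (t i) • e i) ω = conj (t i) * e i ω := by
    rw [ae_all_iff]
    intro i
    filter_upwards [Lp.coeFn_smul (conj (t i)) (e i)] with ω h1
    rw [h1, Pi.smul_apply, smul_eq_mul]
  filter_upwards [this] with ω hω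
  rw [Finset.sum_apply]
  exact Finset.sum_congr rfl fun i _ => hω i

namespace IsStdGaussianFamily

lemma charFun_map [IsProbabilityMeasure P] (h : IsStdGaussianFamily P Ξ) {x : Lp ℂ 2 P} (hx : x ∈ h.space) (t : ℂ) :
    charFun (P.map x) t = Complex.exp (-(‖t‖ ^ 2 * ‖x‖ ^ 2 / 4 : ℝ)) := by
  rw [charFun_map_eq_integral (Lp.aestronglyMeasurable x).aemeasurable]
  have := h.integral_cexp_re (h.space.smul_mem (conj t) hx)
  rw [norm_smul, Complex.norm_conj, mul_pow] at this
  rw [← this]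
  refine integral_congr_ae ?_
  filter_upwards [Lp.coeFn_smul (conj t) x] with ω hω
  rw [hω, Pi.smul_apply, smul_eq_mul]

lemma hasLaw_of_norm_eq_one [IsProbabilityMeasure P] (h : IsStdGaussianFamily P Ξ) {x : Lp ℂ 2 P} (hx : x ∈ h.space)
    (h1 : ‖x‖ = 1) : HasLaw x stdComplexGaussian P := by
  have hm : AEMeasurable x P := (Lp.aestronglyMeasurable x).aemeasurable
  refine ⟨hm, ?_⟩
  have : IsProbabilityMeasure (P.map x) := Measure.isProbabilityMeasure_map hm
  refine Measure.ext_of_charFun (funext fun t => ?_)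
  rw [h.charFun_map hx, charFun_stdComplexGaussian, h1]
  simp

/-- An orthonormal family in the Gaussian Hilbert space is a standard Gaussian family. -/
lemma of_orthonormal [IsProbabilityMeasure P] (h : IsStdGaussianFamily P Ξ) {ι : Type*} {e : ι → Lp ℂ 2 P}
    (he : Orthonormal ℂ e) (hmem : ∀ i, e i ∈ h.space) :
    IsStdGaussianFamily P fun i => ⇑(e i) := by
  have hm : ∀ i, AEMeasurable (e i) P := fun i => (Lp.aestronglyMeasurable (e i)).aemeasurable
  refine ⟨fun i => h.hasLaw_of_norm_eq_one (hmem i) (he.1 i), ?_⟩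
  rw [iIndepFun_iff_finset]
  intro s
  refine (iIndepFun_iff_charFun_pi (X := fun i : s => ⇑(e i)) fun i => hm i).2 fun t => ?_
  have hm2 : AEMeasurable (fun ω => WithLp.toLp 2 (fun i : s => e i ω)) P :=
    (WithLp.measurable_toLp 2 _).comp_aemeasurable (aemeasurable_pi_iff.2 fun i => hm i)
  -- The joint characteristic function at `t` is the one-variable integral for $\sum_i \bar t_i
  -- e_i$, whose squared norm is $\sum_i|t_i|^2$; hence it factors.
  have h1 := h.integral_cexp_re (x := ∑ i : s, conj (t i) • e i)
    (Submodule.sum_mem _ fun i _ => h.space.smul_mem _ (hmem i))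
  have hnorm : ‖∑ i : s, conj (t i) • e i‖ ^ 2 = ∑ i : s, ‖t i‖ ^ 2 := by
    simpa using norm_sq_sum_smul_of_orthonormal (he.comp ((↑) : s → ι) Subtype.val_injective)
      (fun i => conj (t i)) Finset.univ
  change charFun (P.map (fun ω => WithLp.toLp 2 (fun i : s => e i ω))) t =
    ∏ i : s, charFun (P.map (e i)) (t i)
  simp_rw [fun i : s => h.charFun_map (hmem i) (t i), he.1]
  rw [← Complex.exp_sum, charFun_apply, integral_map hm2 (by fun_prop)]
  rw [hnorm] at h1
  convert h1 using 1
  · refine integral_congr_ae ?_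
    filter_upwards [sum_conj_smul_coeFn (fun i : s => e i) t] with ω hω
    rw [hω]
    congr 3
    rw [PiLp.inner_apply, Complex.re_sum]
    refine Finset.sum_congr rfl fun i _ => ?_
    simp only [Complex.inner, mul_comm, Complex.mul_re, Complex.conj_re, Complex.conj_im]
    ring
  · congr 1
    push_cast
    rw [Finset.sum_neg_distrib, Finset.sum_div]
    simp

end IsStdGaussianFamily
end

/-! ### Series in the Gaussian Hilbert space: almost sure convergence and tails. -/

section

variable {Ω J : Type*} [MeasurableSpace Ω] {P : Measure Ω} {Ξ : J → Ω → ℂ}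

namespace IsStdGaussianFamily

lemma eLpNorm_sub_sum (h : IsStdGaussianFamily P Ξ) {ξ : Ω → ℂ} {x : Lp ℂ 2 P} (hx : x =ᵐ[P] ξ)
    (a : J → ℂ) (s : Finset J) :
    eLpNorm (fun ω => ξ ω - ∑ j ∈ s, a j * Ξ j ω) 2 P = edist (∑ j ∈ s, a j • h.vec j) x := by
  rw [edist_comm, edist_eq_enorm_sub, Lp.enorm_def]
  refine eLpNorm_congr_ae ?_
  have : ∀ᵐ ω ∂P, ∀ j ∈ s, (a j • h.vec j) ω = a j * Ξ j ω := by
    rw [Filter.eventually_all_finset]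
    intro j _
    filter_upwards [Lp.coeFn_smul (a j) (h.vec j), h.coeFn_vec j] with ω h1 h2
    rw [h1, Pi.smul_apply, h2, smul_eq_mul]
  filter_upwards [hx, this, Lp.coeFn_sub x (∑ j ∈ s, a j • h.vec j),
    Lp.coeFn_finsetSum s (fun j => a j • h.vec j)] with ω h1 h2 h3 h4
  rw [h3, Pi.sub_apply, h4, Finset.sum_apply, h1]
  congr 1
  exact Finset.sum_congr rfl fun j hj => (h2 j hj).symm

/-- Elements of the Gaussian Hilbert space are square summable combinations of the generators. -/
lemma inGaussianSpace_of_mem_space (h : IsStdGaussianFamily P Ξ) {x : Lp ℂ 2 P}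
    (hx : x ∈ h.space) : InGaussianSpace P Ξ x := by
  refine ⟨(Lp.aestronglyMeasurable x).aemeasurable, ?_⟩
  have hV := h.orthonormal_vec.orthogonalFamily
  have hle : h.space ≤ LinearMap.range hV.linearIsometry.toLinearMap := by
    rw [hV.range_linearIsometry]
    refine Submodule.topologicalClosure_mono (Submodule.span_le.2 ?_)
    rintro _ ⟨j, rfl⟩
    exact Submodule.mem_iSup_of_mem j ⟨1, by simp⟩
  obtain ⟨f, hf⟩ := hle hx
  have hs := hV.hasSum_linearIsometry f
  refine ⟨fun j => f j, ?_, ?_⟩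
  · have := lp.hasSum_norm (p := 2) (by norm_num) f
    simpa using this.summable
  · simp_rw [h.eLpNorm_sub_sum (EventuallyEq.refl _ x)]
    rw [← tendsto_iff_edist_tendsto_0, ← hf]
    simpa [HasSum] using hs

/-- Square summable combinations of the generators are elements of the Gaussian Hilbert space. -/
lemma exists_toLp_mem_space (h : IsStdGaussianFamily P Ξ) {ξ : Ω → ℂ}
    (hξ : InGaussianSpace P Ξ ξ) : ∃ hm : MemLp ξ 2 P, hm.toLp ξ ∈ h.space := by
  obtain ⟨hmeas, a, -, ha⟩ := hξ
  have hm : MemLp ξ 2 P := by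
    obtain ⟨s, hs⟩ := (ha.eventually (gt_mem_nhds (zero_lt_one (α := ℝ≥0∞)))).exists
    have hsum : MemLp (fun ω => ∑ j ∈ s, a j * Ξ j ω) 2 P :=
      memLp_finsetSum s fun j _ => (memLp_of_hasLaw (h.hasLaw j)).const_mul (a j)
    have hd : MemLp (fun ω => ξ ω - ∑ j ∈ s, a j * Ξ j ω) 2 P :=
      ⟨hmeas.aestronglyMeasurable.sub hsum.1, hs.trans (by simp)⟩
    exact (hd.add hsum).ae_eq (ae_of_all _ fun ω => by simp)
  refine ⟨hm, ?_⟩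
  simp_rw [h.eLpNorm_sub_sum hm.coeFn_toLp] at ha
  rw [← tendsto_iff_edist_tendsto_0] at ha
  exact h.isClosed_space.mem_of_tendsto ha (Eventually.of_forall fun s =>
    Submodule.sum_mem _ fun j _ => h.space.smul_mem _ (h.vec_mem_space j))

end IsStdGaussianFamily

variable [IsProbabilityMeasure P]

lemma lintegral_enorm_le_enorm (x : Lp ℂ 2 P) : ∫⁻ ω, ‖x ω‖ₑ ∂P ≤ ‖x‖ₑ := by
  rw [← eLpNorm_one_eq_lintegral_enorm, Lp.enorm_def]
  exact eLpNorm_le_eLpNorm_of_exponent_le (by norm_num) (Lp.aestronglyMeasurable x)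

/-- An absolutely convergent series in `L²` converges absolutely almost surely. -/
lemma ae_summable_norm {x : ℕ → Lp ℂ 2 P} (hx : Summable fun k => ‖x k‖) :
    ∀ᵐ ω ∂P, Summable fun k => ‖x k ω‖ := by
  have hm : ∀ k, AEMeasurable (fun ω => ‖x k ω‖ₑ) P := fun k =>
    (Lp.aestronglyMeasurable (x k)).enorm
  have h1 : ∫⁻ ω, ∑' k, ‖x k ω‖ₑ ∂P ≠ ⊤ := by
    rw [lintegral_tsum hm]
    refine ne_top_of_le_ne_top ?_ (ENNReal.tsum_le_tsum fun k => lintegral_enorm_le_enorm (x k))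
    simp_rw [enorm_eq_nnnorm]
    rw [ENNReal.tsum_coe_ne_top_iff_summable]
    exact NNReal.summable_coe.1 hx
  filter_upwards [ae_lt_top' (AEMeasurable.tsum hm) h1] with ω hω
  have h2 := hω.ne
  simp_rw [enorm_eq_nnnorm] at h2
  rw [ENNReal.tsum_coe_ne_top_iff_summable] at h2
  exact NNReal.summable_coe.2 h2

/-- The almost sure sum of an absolutely convergent series in `L²` is its sum in `L²`. -/
lemma ae_hasSum_of_hasSum {x : ℕ → Lp ℂ 2 P} (hx : Summable fun k => ‖x k‖) {y : Lp ℂ 2 P}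
    (hy : HasSum x y) : ∀ᵐ ω ∂P, HasSum (fun k => x k ω) (y ω) := by
  have hsum := ae_summable_norm hx
  have hpart : ∀ n, ⇑(∑ k ∈ Finset.range n, x k) =ᵐ[P] fun ω => ∑ k ∈ Finset.range n, x k ω := by
    intro n
    filter_upwards [Lp.coeFn_finsetSum (Finset.range n) x] with ω hω
    rw [hω, Finset.sum_apply]
  -- The partial sums converge in measure both to `y` and to the almost sure sum, and limits in
  -- measure are almost everywhere unique.
  have h1 : TendstoInMeasure P (fun n => ⇑(∑ k ∈ Finset.range n, x k)) atTop y :=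
    tendstoInMeasure_of_tendsto_Lp hy.tendsto_sum_nat
  have h2 : TendstoInMeasure P (fun n => ⇑(∑ k ∈ Finset.range n, x k)) atTop
      (fun ω => ∑' k, x k ω) := by
    refine tendstoInMeasure_of_tendsto_ae (fun n => Lp.aestronglyMeasurable _) ?_
    filter_upwards [hsum, ae_all_iff.2 hpart] with ω hω hω2
    simp_rw [hω2]
    exact hω.of_norm.hasSum.tendsto_sum_nat
  filter_upwards [hsum, tendstoInMeasure_ae_unique h1 h2] with ω hω hω2
  rw [hω2]
  exact hω.of_norm.hasSum

namespace IsStdGaussianFamily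

/-- After normalising `x` to unit norm the integral is exactly 2, and enlarging the divisor to `d`
only decreases it. This 2 becomes the prefactor of the tail bound. -/
lemma lintegral_exp_half_sq_le (h : IsStdGaussianFamily P Ξ) {x : Lp ℂ 2 P} (hx : x ∈ h.space)
    {d : ℝ} (hd : 0 < d) (hxd : ‖x‖ ≤ d) :
    ∫⁻ ω, ENNReal.ofReal (Real.exp ((‖x ω‖ / d) ^ 2 / 2)) ∂P ≤ 2 := by
  rcases eq_or_ne x 0 with rfl | hx0
  · have : ∀ᵐ ω ∂P, ENNReal.ofReal (Real.exp ((‖(0 : Lp ℂ 2 P) ω‖ / d) ^ 2 / 2)) = 1 := by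
      filter_upwards [Lp.coeFn_zero ℂ 2 P] with ω hω
      rw [hω]
      simp
    rw [lintegral_congr_ae this]
    simp
  · have hn : 0 < ‖x‖ := norm_pos_iff.2 hx0
    have hlaw := h.hasLaw_of_norm_eq_one (h.space.smul_mem ((‖x‖⁻¹ : ℝ) : ℂ) hx)
      (by rw [norm_smul, Complex.norm_real, norm_inv, norm_norm, inv_mul_cancel₀ hn.ne'])
    have hexp := hlaw.lintegral_comp
      (f := fun z => ENNReal.ofReal (Real.exp (‖z‖ ^ 2 / 2))) (by fun_prop)
    rw [lintegral_exp_half_sq_norm_stdComplexGaussian] at hexp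
    refine le_trans (lintegral_mono_ae ?_) hexp.le
    filter_upwards [Lp.coeFn_smul ((‖x‖⁻¹ : ℝ) : ℂ) x] with ω hω
    rw [hω, Pi.smul_apply, norm_smul, Complex.norm_real, norm_inv, norm_norm, inv_mul_eq_div]
    gcongr

/-- Convexity replaces independence: with weights $d_k/S$, Jensen for the square and then for the
exponential bounds $e^{t^2/2}$ on the event by an average of the $e^{(|x_k|/d_k)^2/2}$. That average
has mean at most 2, and Markov's inequality concludes. -/
lemma measure_lt_sum_norm_le (h : IsStdGaussianFamily P Ξ) {x : ℕ → Lp ℂ 2 P}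
    (hx : ∀ k, x k ∈ h.space) {d : ℕ → ℝ} (hd : ∀ k, 0 < d k) (hxd : ∀ k, ‖x k‖ ≤ d k)
    {D : ℝ} (n : ℕ) (hD : ∑ k ∈ Finset.range n, d k ≤ D) {t : ℝ} (ht : 0 ≤ t) :
    P {ω | t * D < ∑ k ∈ Finset.range n, ‖x k ω‖} ≤
      ENNReal.ofReal (2 * Real.exp (-(1 / 2) * t ^ 2)) := by
  set S := ∑ k ∈ Finset.range n, d k with hS
  rcases Nat.eq_zero_or_pos n with rfl | hn
  · have hD0 : 0 ≤ D := by simpa [hS] using hD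
    have : {ω | t * D < ∑ k ∈ Finset.range 0, ‖x k ω‖} = ∅ := by
      ext ω
      simpa using mul_nonneg ht hD0
    rw [this]
    simp
  have hS0 : 0 < S := Finset.sum_pos (fun k _ => hd k) (by simpa using hn.ne')
  set g : Ω → ℝ≥0∞ := fun ω => ∑ k ∈ Finset.range n,
    ENNReal.ofReal (d k / S) * ENNReal.ofReal (Real.exp ((‖x k ω‖ / d k) ^ 2 / 2)) with hg
  have hmk : ∀ k, AEMeasurable
      (fun ω => ENNReal.ofReal (Real.exp ((‖x k ω‖ / d k) ^ 2 / 2))) P := by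
    intro k
    have := (Lp.aestronglyMeasurable (x k)).aemeasurable
    fun_prop
  have hgm : AEMeasurable g P := by fun_prop
  have hw : ∑ k ∈ Finset.range n, d k / S = 1 := by
    rw [← Finset.sum_div, div_self hS0.ne']
  have hgi : ∫⁻ ω, g ω ∂P ≤ 2 := by
    rw [hg, lintegral_finsetSum' _ (fun k _ => (hmk k).const_mul _)]
    calc _ ≤ ∑ k ∈ Finset.range n, ENNReal.ofReal (d k / S) * 2 := by
          refine Finset.sum_le_sum fun k _ => ?_
          rw [lintegral_const_mul'' _ (hmk k)]
          gcongr
          exact h.lintegral_exp_half_sq_le (hx k) (hd k) (hxd k)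
      _ = 2 := by
          rw [← Finset.sum_mul, ← ENNReal.ofReal_sum_of_nonneg
            (fun k _ => div_nonneg (hd k).le hS0.le), hw]
          simp
  have hsub : {ω | t * D < ∑ k ∈ Finset.range n, ‖x k ω‖} ⊆
      {ω | ENNReal.ofReal (Real.exp (t ^ 2 / 2)) ≤ g ω} := by
    intro ω hω
    simp only [Set.mem_ofPred_eq] at hω ⊢
    have h1 : t ≤ ∑ k ∈ Finset.range n, (d k / S) * (‖x k ω‖ / d k) := by
      have : ∀ k ∈ Finset.range n, (d k / S) * (‖x k ω‖ / d k) = ‖x k ω‖ / S := by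
        intro k _
        have := (hd k).ne'
        field_simp
      rw [Finset.sum_congr rfl this, ← Finset.sum_div, le_div_iff₀ hS0]
      exact (mul_le_mul_of_nonneg_left hD ht).trans hω.le
    have h2 : t ^ 2 ≤ ∑ k ∈ Finset.range n, (d k / S) * (‖x k ω‖ / d k) ^ 2 := by
      refine (pow_le_pow_left₀ ht h1 2).trans ?_
      simpa using (even_two.convexOn_pow (𝕜 := ℝ)).map_sum_le (t := Finset.range n)
        (w := fun k => d k / S) (p := fun k => ‖x k ω‖ / d k)
        (fun k _ => div_nonneg (hd k).le hS0.le) hw (fun _ _ => Set.mem_univ _)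
    have h3 : Real.exp (t ^ 2 / 2) ≤
        ∑ k ∈ Finset.range n, (d k / S) * Real.exp ((‖x k ω‖ / d k) ^ 2 / 2) := by
      have := convexOn_exp.map_sum_le (t := Finset.range n)
        (w := fun k => d k / S) (p := fun k => (‖x k ω‖ / d k) ^ 2 / 2)
        (fun k _ => div_nonneg (hd k).le hS0.le) hw (fun _ _ => Set.mem_univ _)
      simp only [smul_eq_mul] at this
      refine (Real.exp_le_exp.2 ?_).trans this
      calc t ^ 2 / 2 ≤ (∑ k ∈ Finset.range n, (d k / S) * (‖x k ω‖ / d k) ^ 2) / 2 := by gcongr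
        _ = _ := by
          rw [Finset.sum_div]
          exact Finset.sum_congr rfl fun k _ => by ring
    calc _ ≤ _ := ENNReal.ofReal_le_ofReal h3
      _ = g ω := by
        rw [ENNReal.ofReal_sum_of_nonneg fun k _ =>
          mul_nonneg (div_nonneg (hd k).le hS0.le) (Real.exp_pos _).le]
        exact Finset.sum_congr rfl fun k _ =>
          ENNReal.ofReal_mul (div_nonneg (hd k).le hS0.le)
  refine (measure_mono hsub).trans ?_
  refine (meas_ge_le_lintegral_div hgm (by simp [Real.exp_pos]) ENNReal.ofReal_ne_top).trans ?_
  refine (ENNReal.div_le_div_right hgi _).trans_eq ?_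
  rw [ENNReal.ofReal_mul (by norm_num), ENNReal.div_eq_inv_mul,
    ← ENNReal.ofReal_inv_of_pos (Real.exp_pos _), ← Real.exp_neg, mul_comm]
  congr 1
  · simp
  · congr 2
    ring

/-- Subgaussian tail of an absolutely convergent series of Gaussian variables. -/
lemma measure_exists_lt_sum_norm_le (h : IsStdGaussianFamily P Ξ) {x : ℕ → Lp ℂ 2 P}
    (hx : ∀ k, x k ∈ h.space) {d : ℕ → ℝ} (hd : ∀ k, 0 < d k) (hxd : ∀ k, ‖x k‖ ≤ d k)
    {D : ℝ} (hD : ∀ n, ∑ k ∈ Finset.range n, d k ≤ D) {t : ℝ} (ht : 0 ≤ t) :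
    P {ω | ∃ n, t * D < ∑ k ∈ Finset.range n, ‖x k ω‖} ≤
      ENNReal.ofReal (2 * Real.exp (-(1 / 2) * t ^ 2)) := by
  rw [Set.ofPred_exists, Monotone.measure_iUnion]
  · exact iSup_le fun n => h.measure_lt_sum_norm_le hx hd hxd n (hD n) ht
  · intro m n hmn ω hω
    exact lt_of_lt_of_le hω (Finset.sum_le_sum_of_subset_of_nonneg
      (Finset.range_mono hmn) fun _ _ _ => norm_nonneg _)

end IsStdGaussianFamily
end

/-! ### Almost orthonormal families and Gram–Schmidt. -/

section

variable {H : Type*} [NormedAddCommGroup H] [InnerProductSpace ℂ H]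

/-- The Schur test: a lower Riesz bound for an almost orthonormal family. -/
lemma mul_sum_sq_le_norm_sum_sq {ι : Type*} [DecidableEq ι] {ζ : ι → H} (hn : ∀ i, ‖ζ i‖ = 1)
    {σ : ℝ} (hs : ∀ n (s : Finset ι), n ∉ s → ∑ i ∈ s, ‖inner ℂ (ζ i) (ζ n)‖ ≤ σ)
    (u : ι → ℂ) (s : Finset ι) :
    (1 - σ) * ∑ i ∈ s, ‖u i‖ ^ 2 ≤ ‖∑ i ∈ s, u i • ζ i‖ ^ 2 := by
  set a : ι → ι → ℝ := fun i j => if i = j then 0 else ‖inner ℂ (ζ i) (ζ j)‖ with ha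
  have ha0 : ∀ i j, 0 ≤ a i j := fun i j => by
    simp only [ha]
    split_ifs <;> positivity
  have hsymm : ∀ i j, a i j = a j i := fun i j => by
    simp only [ha, eq_comm (a := i), norm_inner_symm (ζ i)]
  have hrow : ∀ j, ∑ i ∈ s, a i j ≤ σ := fun j => by
    rw [← Finset.sum_filter_add_sum_filter_not s (· = j)]
    have h1 : ∑ i ∈ s with i = j, a i j = 0 :=
      Finset.sum_eq_zero fun i hi => by simp [ha, (Finset.mem_filter.1 hi).2]
    have h2 : ∑ i ∈ s with ¬ i = j, a i j = ∑ i ∈ s with ¬ i = j, ‖inner ℂ (ζ i) (ζ j)‖ :=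
      Finset.sum_congr rfl fun i hi => by simp [ha, (Finset.mem_filter.1 hi).2]
    rw [h1, h2, zero_add]
    exact hs j _ (by simp)
  -- The inequality $|u_i||u_j|\le(|u_i|^2+|u_j|^2)/2$ charges each off-diagonal entry half to its
  -- row and half to its column; by symmetry both sums are at most `σ`.
  have hterm : ∀ i j, (if i = j then ‖u i‖ ^ 2 else 0) -
      (a i j * ‖u i‖ ^ 2 / 2 + a i j * ‖u j‖ ^ 2 / 2) ≤
      RCLike.re (inner ℂ (u i • ζ i) (u j • ζ j)) := by
    intro i j
    by_cases hij : i = j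
    · subst hij
      rw [← @norm_sq_eq_re_inner ℂ]
      simp [ha, norm_smul, hn]
    · simp only [ha, hij, if_false]
      have h1 : |RCLike.re (inner ℂ (u i • ζ i) (u j • ζ j))| ≤
          ‖u i‖ * ‖u j‖ * ‖inner ℂ (ζ i) (ζ j)‖ := by
        refine (RCLike.abs_re_le_norm _).trans_eq ?_
        rw [inner_smul_left, inner_smul_right, norm_mul, norm_mul, RCLike.norm_conj, mul_assoc]
      have h2 := (abs_le.1 h1).1
      have h3 : ‖u i‖ * ‖u j‖ ≤ ‖u i‖ ^ 2 / 2 + ‖u j‖ ^ 2 / 2 := by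
        nlinarith [sq_nonneg (‖u i‖ - ‖u j‖)]
      have h4 := mul_le_mul_of_nonneg_right h3 (norm_nonneg (inner ℂ (ζ i) (ζ j)))
      linarith
  have hrow' : ∑ i ∈ s, ∑ j ∈ s, a i j * ‖u j‖ ^ 2 / 2 ≤ (σ * ∑ i ∈ s, ‖u i‖ ^ 2) / 2 := by
    rw [Finset.sum_comm, Finset.mul_sum, Finset.sum_div]
    refine Finset.sum_le_sum fun j _ => ?_
    rw [← Finset.sum_div, ← Finset.sum_mul]
    have := hrow j
    gcongr
  have hrow'' : ∑ i ∈ s, ∑ j ∈ s, a i j * ‖u i‖ ^ 2 / 2 ≤ (σ * ∑ i ∈ s, ‖u i‖ ^ 2) / 2 := by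
    rw [Finset.sum_comm]
    simpa only [hsymm] using hrow'
  calc (1 - σ) * ∑ i ∈ s, ‖u i‖ ^ 2
      ≤ ∑ i ∈ s, ∑ j ∈ s, ((if i = j then ‖u i‖ ^ 2 else 0) -
        (a i j * ‖u i‖ ^ 2 / 2 + a i j * ‖u j‖ ^ 2 / 2)) := by
        simp only [Finset.sum_sub_distrib, Finset.sum_add_distrib, Finset.sum_ite_eq]
        have : ∑ i ∈ s, (if i ∈ s then ‖u i‖ ^ 2 else 0) = ∑ i ∈ s, ‖u i‖ ^ 2 :=
          Finset.sum_congr rfl fun i hi => by simp [hi]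
        rw [this]
        linarith
    _ ≤ ∑ i ∈ s, ∑ j ∈ s, RCLike.re (inner ℂ (u i • ζ i) (u j • ζ j)) :=
        Finset.sum_le_sum fun i _ => Finset.sum_le_sum fun j _ => hterm i j
    _ = ‖∑ i ∈ s, u i • ζ i‖ ^ 2 := by
        rw [@norm_sq_eq_re_inner ℂ, sum_inner, map_sum]
        simp_rw [inner_sum, map_sum]

/-- The Riesz bound with $1-\sigma\ge1/2$ gives $|u_i|\le 2\|y\|$ for each coefficient of $y=\sum_i
u_i\zeta_i$. A sup bound is enough, since the inner products with `ζ n` are summable with sum at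
most `σ`. -/
lemma norm_inner_sum_le {ι : Type*} [DecidableEq ι] {ζ : ι → H} (hn : ∀ i, ‖ζ i‖ = 1)
    {σ : ℝ} (hσ : σ ≤ 1 / 2)
    (hs : ∀ n (s : Finset ι), n ∉ s → ∑ i ∈ s, ‖inner ℂ (ζ i) (ζ n)‖ ≤ σ)
    (u : ι → ℂ) {s : Finset ι} {n : ι} (hns : n ∉ s) :
    ‖inner ℂ (∑ i ∈ s, u i • ζ i) (ζ n)‖ ≤ 2 * σ * ‖∑ i ∈ s, u i • ζ i‖ := by
  set y := ∑ i ∈ s, u i • ζ i with hy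
  have h1 := mul_sum_sq_le_norm_sum_sq hn hs u s
  rw [← hy] at h1
  have hu : ∀ i ∈ s, ‖u i‖ ≤ 2 * ‖y‖ := by
    intro i hi
    have h2 : ‖u i‖ ^ 2 ≤ ∑ i ∈ s, ‖u i‖ ^ 2 :=
      Finset.single_le_sum (f := fun i => ‖u i‖ ^ 2) (fun _ _ => by positivity) hi
    refine le_of_sq_le_sq ?_ (by positivity)
    nlinarith [norm_nonneg y, sq_nonneg ‖y‖, sq_nonneg ‖u i‖]
  calc ‖inner ℂ y (ζ n)‖ ≤ ∑ i ∈ s, ‖inner ℂ (u i • ζ i) (ζ n)‖ := by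
        rw [hy, sum_inner]
        exact norm_sum_le _ _
    _ ≤ ∑ i ∈ s, 2 * ‖y‖ * ‖inner ℂ (ζ i) (ζ n)‖ := by
        refine Finset.sum_le_sum fun i hi => ?_
        rw [inner_smul_left, norm_mul, RCLike.norm_conj]
        gcongr
        exact hu i hi
    _ ≤ 2 * ‖y‖ * σ := by
        rw [← Finset.mul_sum]
        gcongr
        exact hs n s hns
    _ = _ := by ring

open InnerProductSpace in
/-- Gram–Schmidt moves an almost orthonormal sequence only a little. -/
lemma exists_orthonormal_near_nat {ζ : ℕ → H} (hn : ∀ i, ‖ζ i‖ = 1) {σ : ℝ} (hσ : σ ≤ 1 / 2)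
    (hs : ∀ n (s : Finset ℕ), n ∉ s → ∑ i ∈ s, ‖inner ℂ (ζ i) (ζ n)‖ ≤ σ) :
    ∃ η : ℕ → H, Orthonormal ℂ η ∧ (∀ n, η n ∈ Submodule.span ℂ (Set.range ζ)) ∧
      ∀ n, ‖ζ n - η n‖ ≤ 4 * σ := by
  have hli : LinearIndependent ℂ ζ := by
    rw [linearIndependent_iff']
    intro s u hu i hi
    have h1 := mul_sum_sq_le_norm_sum_sq hn hs u s
    rw [hu, norm_zero] at h1
    have h2 : ‖u i‖ ^ 2 ≤ ∑ i ∈ s, ‖u i‖ ^ 2 :=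
      Finset.single_le_sum (f := fun i => ‖u i‖ ^ 2) (fun _ _ => by positivity) hi
    have h3 : ‖u i‖ ^ 2 ≤ 0 := by nlinarith [sq_nonneg ‖u i‖]
    simpa using h3
  refine ⟨gramSchmidtNormed ℂ ζ, gramSchmidtNormed_orthonormal hli, fun n => ?_, fun n => ?_⟩
  · rw [← span_gramSchmidt ℂ ζ, ← span_gramSchmidtNormed_range]
    exact Submodule.subset_span ⟨n, rfl⟩
  set g := gramSchmidt ℂ ζ n with hg
  have hmem' : ζ n - g ∈ Submodule.span ℂ (gramSchmidt ℂ ζ '' Set.Iio n) := by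
    rw [hg, gramSchmidt_def, sub_sub_cancel]
    refine Submodule.sum_mem _ fun i hi => ?_
    refine Submodule.span_mono ?_ (Submodule.starProjection_apply_mem _ _)
    rw [Set.singleton_subset_iff]
    exact ⟨i, by simpa using hi, rfl⟩
  have horth : inner ℂ (ζ n - g) g = 0 := by
    have hle : Submodule.span ℂ (gramSchmidt ℂ ζ '' Set.Iio n) ≤ (Submodule.span ℂ {g})ᗮ := by
      rw [Submodule.span_le]
      rintro _ ⟨i, hi, rfl⟩
      rw [SetLike.mem_coe, Submodule.mem_orthogonal_singleton_iff_inner_left]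
      exact gramSchmidt_orthogonal ℂ ζ (ne_of_lt hi)
    exact Submodule.mem_orthogonal_singleton_iff_inner_left.1 (hle hmem')
  -- Here $p=\zeta_n-g$ is the projection of $\zeta_n$ to the span of its predecessors, so
  -- $\|p\|^2=\langle p,\zeta_n\rangle\le2\sigma\|p\|$.
  have hp : ‖ζ n - g‖ ≤ 2 * σ := by
    rw [span_gramSchmidt_Iio, ← Finset.coe_Iio,
      Submodule.mem_span_image_finset_iff_exists_fun'] at hmem'
    obtain ⟨u, hu⟩ := hmem'
    have h1 := norm_inner_sum_le hn hσ hs u (s := Finset.Iio n) (n := n) (by simp)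
    rw [hu] at h1
    have h2 : inner ℂ (ζ n - g) (ζ n) = inner ℂ (ζ n - g) (ζ n - g) := by
      rw [inner_sub_right (ζ n - g) (ζ n) g, horth, sub_zero]
    rw [h2, inner_self_eq_norm_sq_to_K, norm_pow, RCLike.norm_ofReal, abs_norm, sq] at h1
    rcases eq_or_lt_of_le (norm_nonneg (ζ n - g)) with h0 | h0
    · rw [← h0]
      have := hs n ∅ (by simp)
      simp at this
      linarith
    · exact le_of_mul_le_mul_right h1 h0
  have hg0 : g ≠ 0 := gramSchmidt_ne_zero n hli
  have hgn : ‖g‖ ≠ 0 := norm_ne_zero_iff.2 hg0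
  -- Normalising moves $g$ by $|\|g\|-\|\zeta_n\||\le\|g-\zeta_n\|$, since $\|\zeta_n\|=1$.
  have h3 : ‖g - gramSchmidtNormed ℂ ζ n‖ ≤ 2 * σ := by
    have h4 : g - gramSchmidtNormed ℂ ζ n = ((1 - ‖g‖⁻¹ : ℝ) : ℂ) • g := by
      rw [gramSchmidtNormed, ← hg]
      push_cast
      rw [sub_smul, one_smul]
      rfl
    rw [h4, norm_smul, Complex.norm_real, Real.norm_eq_abs, ← abs_norm g, ← abs_mul, abs_norm,
      sub_mul, one_mul, inv_mul_cancel₀ hgn, ← hn n]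
    refine (abs_norm_sub_norm_le _ _).trans ?_
    rwa [norm_sub_rev]
  calc ‖ζ n - gramSchmidtNormed ℂ ζ n‖ ≤ ‖ζ n - g‖ + ‖g - gramSchmidtNormed ℂ ζ n‖ :=
        norm_sub_le_norm_sub_add_norm_sub _ _ _
    _ ≤ 4 * σ := by linarith

/-- An almost orthonormal countable family is close to an orthonormal one. -/
lemma exists_orthonormal_near {ι : Type*} (e : ι ≃ ℕ) {ζ : ι → H} (hn : ∀ i, ‖ζ i‖ = 1) {σ : ℝ}
    (hσ : σ ≤ 1 / 2)
    (hs : ∀ n (s : Finset ι), n ∉ s → ∑ i ∈ s, ‖inner ℂ (ζ i) (ζ n)‖ ≤ σ) :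
    ∃ η : ι → H, Orthonormal ℂ η ∧ (∀ n, η n ∈ Submodule.span ℂ (Set.range ζ)) ∧
      ∀ n, ‖ζ n - η n‖ ≤ 4 * σ := by
  obtain ⟨η, h1, h2, h3⟩ := exists_orthonormal_near_nat (ζ := ζ ∘ e.symm) (fun i => hn _) hσ
    (fun n s hns => by
      have := hs (e.symm n) (s.map e.symm.toEmbedding) (by simpa using hns)
      simpa using this)
  refine ⟨η ∘ e, h1.comp _ e.injective, fun n => ?_, fun n => ?_⟩
  · rw [← e.symm.surjective.range_comp]
    exact h2 _
  · simpa using h3 (e n)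

end

/-! ### Fock weights, coherent vectors and the coefficients of shifts. -/

section

/-- The weight `z ^ k / √(k!)` of the `k`-th coefficient of a Gaussian entire function. -/
def fockWeight (k : ℕ) (z : ℂ) : ℂ := z ^ k / (Real.sqrt (k.factorial : ℝ) : ℂ)

lemma sqrt_factorial_pos (k : ℕ) : 0 < Real.sqrt (k.factorial : ℝ) :=
  Real.sqrt_pos.2 (by exact_mod_cast k.factorial_pos)

lemma sqrt_factorial_sq (k : ℕ) : Real.sqrt (k.factorial : ℝ) ^ 2 = k.factorial :=
  Real.sq_sqrt (Nat.cast_nonneg _)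

lemma norm_fockWeight (k : ℕ) (z : ℂ) :
    ‖fockWeight k z‖ = ‖z‖ ^ k / Real.sqrt (k.factorial : ℝ) := by
  rw [fockWeight, norm_div, norm_pow, Complex.norm_real, Real.norm_of_nonneg (Real.sqrt_nonneg _)]

lemma differentiable_fockWeight (k : ℕ) : Differentiable ℂ (fockWeight k) := by
  unfold fockWeight
  fun_prop

lemma norm_fockWeight_le_of_norm_le {z : ℂ} {r : ℝ} (h : ‖z‖ ≤ r) (k : ℕ) :
    ‖fockWeight k z‖ ≤ r ^ k / Real.sqrt (k.factorial : ℝ) := by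
  rw [norm_fockWeight]
  gcongr

/-- The inequality of arithmetic and geometric means for the factors $2^{-k/2}$ and
$(\sqrt2\,r)^k/\sqrt{k!}$ gives a geometric plus an exponential series, both summed in closed form.
-/
lemma fockWeight_bound (r : ℝ) (k : ℕ) :
    r ^ k / Real.sqrt (k.factorial : ℝ) ≤
      ((1 / 2) ^ k + (2 * r ^ 2) ^ k / (k.factorial : ℝ)) / 2 := by
  set s := Real.sqrt (k.factorial : ℝ) with hs
  have hs0 : 0 < s := sqrt_factorial_pos k
  set a := Real.sqrt ((1 / 2) ^ k) with ha
  have ha2 : a ^ 2 = (1 / 2) ^ k := Real.sq_sqrt (by positivity)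
  have ha0 : 0 < a := Real.sqrt_pos.2 (by positivity)
  have h1 : (2 * r ^ 2) ^ k / (k.factorial : ℝ) = (r ^ k / (s * a)) ^ 2 := by
    rw [← sqrt_factorial_sq k, ← hs, div_pow, mul_pow s a, ha2, mul_pow, one_div, inv_pow]
    field_simp
    ring
  rw [h1, ← ha2]
  have h2 : r ^ k / s = a * (r ^ k / (s * a)) := by field_simp
  rw [h2]
  nlinarith [sq_nonneg (a - r ^ k / (s * a))]

lemma hasSum_fockWeight_bound (r : ℝ) :
    HasSum (fun k : ℕ => ((1 / 2 : ℝ) ^ k + (2 * r ^ 2) ^ k / (k.factorial : ℝ)) / 2)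
      ((2 + Real.exp (2 * r ^ 2)) / 2) := by
  refine (HasSum.add hasSum_geometric_two ?_).div_const 2
  rw [Real.exp_eq_exp_ℝ]
  exact NormedSpace.expSeries_div_hasSum_exp (2 * r ^ 2)

lemma summable_fockWeight {r : ℝ} (hr : 0 ≤ r) :
    Summable fun k : ℕ => r ^ k / Real.sqrt (k.factorial : ℝ) :=
  Summable.of_nonneg_of_le (fun _ => by positivity) (fockWeight_bound r)
    (hasSum_fockWeight_bound r).summable

lemma summable_norm_fockWeight (z : ℂ) : Summable fun k => ‖fockWeight k z‖ := by
  simp_rw [norm_fockWeight]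
  exact summable_fockWeight (norm_nonneg z)

lemma sum_fockWeight_le (r : ℝ) (s : Finset ℕ) :
    ∑ k ∈ s, r ^ k / Real.sqrt (k.factorial : ℝ) ≤ 2 * Real.exp (2 * r ^ 2) := by
  calc _ ≤ ∑ k ∈ s, ((1 / 2 : ℝ) ^ k + (2 * r ^ 2) ^ k / (k.factorial : ℝ)) / 2 :=
        Finset.sum_le_sum fun k _ => fockWeight_bound r k
    _ ≤ (2 + Real.exp (2 * r ^ 2)) / 2 :=
        sum_le_hasSum s (fun k _ => by positivity) (hasSum_fockWeight_bound r)
    _ ≤ _ := by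
        have := Real.one_le_exp (x := 2 * r ^ 2) (by positivity)
        linarith

/-- The tail of the weight series past `B` is small, with an exponential factor to spare. -/
lemma sum_fockWeight_tail_le {r B : ℝ} (hr : 0 ≤ r) (s : Finset ℕ) (hs : ∀ k ∈ s, B < (k : ℝ)) :
    ∑ k ∈ s, r ^ k / Real.sqrt (k.factorial : ℝ) ≤
      2 * Real.exp (15 * r ^ 2 - B) := by
  have he := Real.exp_one_lt_d9
  have he0 := Real.exp_pos 1
  -- Inserting $e^{k-B}\ge1$ turns $r$ into $er$ in the full weight series; the 15 comes from
  -- $2e^2\le15$.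
  calc _ ≤ ∑ k ∈ s, Real.exp (-B) * ((Real.exp 1 * r) ^ k / Real.sqrt (k.factorial : ℝ)) := by
        refine Finset.sum_le_sum fun k hk => ?_
        have h1 : Real.exp (-B) * ((Real.exp 1 * r) ^ k / Real.sqrt (k.factorial : ℝ)) =
            Real.exp (-B + k * 1) * (r ^ k / Real.sqrt (k.factorial : ℝ)) := by
          rw [Real.exp_add, Real.exp_nat_mul]
          ring
        rw [h1]
        refine le_mul_of_one_le_left (by positivity) (Real.one_le_exp ?_)
        linarith [hs k hk]
    _ ≤ Real.exp (-B) * (2 * Real.exp (2 * (Real.exp 1 * r) ^ 2)) := by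
        rw [← Finset.mul_sum]
        gcongr
        exact sum_fockWeight_le _ s
    _ = 2 * Real.exp (2 * (Real.exp 1 * r) ^ 2 - B) := by
        rw [sub_eq_add_neg, Real.exp_add]
        ring
    _ ≤ _ := by
        refine mul_le_mul_of_nonneg_left (Real.exp_le_exp.2 ?_) zero_le_two
        have h2 : Real.exp 1 ^ 2 ≤ 15 / 2 := by nlinarith
        nlinarith [mul_le_mul_of_nonneg_right h2 (sq_nonneg r)]

/-- For $k\le\rho^2$, the normalisation $\sqrt{k!}$ therefore costs nothing in Cauchy's estimate on
the circle of radius $\rho$. -/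
lemma sqrt_factorial_le_pow {k : ℕ} {ρ : ℝ} (hρ : 0 ≤ ρ) (hk : (k : ℝ) ≤ ρ ^ 2) :
    Real.sqrt (k.factorial : ℝ) ≤ ρ ^ k := by
  rw [Real.sqrt_le_left (by positivity)]
  calc (k.factorial : ℝ) ≤ (k : ℝ) ^ k := by exact_mod_cast Nat.factorial_le_pow k
    _ ≤ (ρ ^ 2) ^ k := by gcongr
    _ = _ := by rw [← pow_mul, ← pow_mul, mul_comm]

lemma fockWeight_conj_mul (k : ℕ) (a b : ℂ) :
    conj (fockWeight k b) * fockWeight k a = (a * conj b) ^ k / (k.factorial : ℂ) := by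
  have h : ((Real.sqrt (k.factorial : ℝ) : ℝ) : ℂ) ^ 2 = k.factorial := by
    exact_mod_cast congrArg Complex.ofReal (sqrt_factorial_sq k)
  rw [fockWeight, fockWeight, map_div₀, map_pow, Complex.conj_ofReal, ← h]
  ring

variable {H : Type*} [NormedAddCommGroup H] [InnerProductSpace ℂ H]

lemma inner_iteratedDeriv {f : ℂ → H} (hf : ContDiff ℂ ⊤ f) (x : H) (k : ℕ) (z : ℂ) :
    inner ℂ x (iteratedDeriv k f z) = iteratedDeriv k (fun z => inner ℂ x (f z)) z := by
  rw [iteratedDeriv_eq_iteratedFDeriv, iteratedDeriv_eq_iteratedFDeriv]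
  have := (innerSL ℂ x).iteratedFDeriv_comp_left (f := f) (x := z) (n := ⊤) (i := k)
    hf.contDiffAt le_top
  have h2 : (innerSL ℂ x) ∘ f = fun z => inner ℂ x (f z) := rfl
  rw [h2] at this
  rw [this]
  rfl

/-- The coherent vectors `∑ z ^ m / √(m!) u_m`. -/
def coherent (u : ℕ → H) (z : ℂ) : H := ∑' m, fockWeight m z • u m

/-- The coherent vectors translated by the Bargmann–Fock shift. -/
def shifted (u : ℕ → H) (w z : ℂ) : H :=
  Complex.exp (-(z * conj w) - (‖w‖ ^ 2 / 2 : ℝ)) • coherent u (w + z)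

/-- The coefficients of `shifted u w` with respect to `z ^ k / √(k!)`. -/
def shiftedCoeff (u : ℕ → H) (w : ℂ) (k : ℕ) : H :=
  ((Real.sqrt (k.factorial : ℝ) : ℂ)⁻¹) • iteratedDeriv k (shifted u w) 0

variable {u : ℕ → H}

lemma summable_norm_fockWeight_smul (hu : Orthonormal ℂ u) (z : ℂ) :
    Summable fun m => ‖fockWeight m z • u m‖ := by
  simp_rw [norm_smul, hu.1, mul_one]
  exact summable_norm_fockWeight z

variable [CompleteSpace H]

lemma hasSum_coherent (hu : Orthonormal ℂ u) (z : ℂ) :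
    HasSum (fun m => fockWeight m z • u m) (coherent u z) :=
  (summable_norm_fockWeight_smul hu z).of_norm.hasSum

lemma differentiable_coherent (hu : Orthonormal ℂ u) : Differentiable ℂ (coherent u) := by
  intro z
  have h : DifferentiableOn ℂ (coherent u) (Metric.ball 0 (‖z‖ + 1)) := by
    refine Complex.differentiableOn_tsum_of_summable_norm
      (summable_fockWeight (r := ‖z‖ + 1) (by positivity)) (fun m => ?_) Metric.isOpen_ball ?_
    · exact ((differentiable_fockWeight m).smul_const (u m)).differentiableOn
    · intro m w hw
      rw [norm_smul, hu.1, mul_one]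
      exact norm_fockWeight_le_of_norm_le (mem_ball_zero_iff.1 hw).le m
  exact h.differentiableAt (Metric.isOpen_ball.mem_nhds (by simp))

lemma inner_coherent (hu : Orthonormal ℂ u) (a b : ℂ) :
    inner ℂ (coherent u b) (coherent u a) = Complex.exp (a * conj b) := by
  have h1 : ∀ n, inner ℂ (u n) (coherent u b) = fockWeight n b := by
    intro n
    refine ((hasSum_coherent hu b).mapL (innerSL ℂ (u n))).unique ?_
    have h : ∀ m, innerSL ℂ (u n) (fockWeight m b • u m) = if m = n then fockWeight n b else 0 := by
      intro m
      rw [innerSL_apply_apply, inner_smul_right, orthonormal_iff_ite.1 hu, mul_ite, mul_one,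
        mul_zero]
      split_ifs <;> simp_all
    simp_rw [h]
    exact hasSum_ite_eq n _
  have h2 := (hasSum_coherent hu a).mapL (innerSL ℂ (coherent u b))
  have h3 := NormedSpace.expSeries_div_hasSum_exp (a * conj b)
  rw [← Complex.exp_eq_exp_ℂ] at h3
  refine h2.unique ?_
  convert! h3 using 2 with m
  rw [innerSL_apply_apply, inner_smul_right, ← inner_conj_symm, h1, mul_comm, fockWeight_conj_mul]

lemma differentiable_shifted (hu : Orthonormal ℂ u) (w : ℂ) : Differentiable ℂ (shifted u w) := by
  have := differentiable_coherent hu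
  unfold shifted
  fun_prop

lemma inner_shifted (hu : Orthonormal ℂ u) (w w' z z' : ℂ) :
    inner ℂ (shifted u w' z') (shifted u w z) =
      Complex.exp (-(conj z' * w') - (‖w'‖ ^ 2 / 2 : ℝ) - z * conj w - (‖w‖ ^ 2 / 2 : ℝ)
        + (w + z) * conj (w' + z')) := by
  rw [shifted, shifted, inner_smul_left, inner_smul_right, inner_coherent hu, ← Complex.exp_conj,
    ← Complex.exp_add, ← Complex.exp_add]
  congr 1
  simp only [map_sub, map_neg, map_mul, Complex.conj_conj, Complex.conj_ofReal]
  ring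

/-- The exponential factors of the shift are exactly those that make the kernel independent of `w`.
-/
lemma inner_shifted_self (hu : Orthonormal ℂ u) (w z z' : ℂ) :
    inner ℂ (shifted u w z') (shifted u w z) = Complex.exp (z * conj z') := by
  rw [inner_shifted hu]
  congr 1
  have h : w * conj w = ((‖w‖ ^ 2 : ℝ) : ℂ) := by
    rw [Complex.mul_conj, Complex.normSq_eq_norm_sq]
  rw [map_add]
  push_cast at h ⊢
  linear_combination h

lemma norm_inner_shifted (hu : Orthonormal ℂ u) (w w' z z' : ℂ) :
    ‖inner ℂ (shifted u w' z') (shifted u w z)‖ =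
      Real.exp (‖z‖ ^ 2 / 2 + ‖z'‖ ^ 2 / 2 - ‖w + z - w' - z'‖ ^ 2 / 2) := by
  rw [inner_shifted hu, Complex.norm_exp]
  congr 1
  simp only [← Complex.normSq_eq_norm_sq, Complex.normSq_apply, Complex.add_re, Complex.sub_re,
    Complex.neg_re, Complex.mul_re, Complex.conj_re, Complex.conj_im, Complex.ofReal_re,
    Complex.add_im, Complex.sub_im, map_add]
  ring

lemma hasSum_shifted (hu : Orthonormal ℂ u) (w z : ℂ) :
    HasSum (fun k => fockWeight k z • shiftedCoeff u w k) (shifted u w z) := by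
  convert! Complex.hasSum_taylorSeries_of_entire (differentiable_shifted hu w) 0 z using 2 with k
  have h : ((Real.sqrt (k.factorial : ℝ) : ℝ) : ℂ) ^ 2 = k.factorial := by
    exact_mod_cast congrArg Complex.ofReal (sqrt_factorial_sq k)
  rw [shiftedCoeff, fockWeight, smul_smul, smul_smul, sub_zero, ← h]
  congr 1
  ring

lemma inner_shiftedCoeff (hu : Orthonormal ℂ u) (x : H) (w : ℂ) (k : ℕ) :
    inner ℂ x (shiftedCoeff u w k) = (Real.sqrt (k.factorial : ℝ) : ℂ)⁻¹ *
      iteratedDeriv k (fun z => inner ℂ x (shifted u w z)) 0 := by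
  rw [shiftedCoeff, inner_smul_right, inner_iteratedDeriv (differentiable_shifted hu w).contDiff]

/-- The kernel $e^{z\bar z'}$ determines the Gram matrix of Taylor coefficients: differentiate once
in each variable, with a conjugation between to swap them. -/
lemma orthonormal_shiftedCoeff (hu : Orthonormal ℂ u) (w : ℂ) :
    Orthonormal ℂ (shiftedCoeff u w) := by
  have h1 : ∀ k z', inner ℂ (shifted u w z') (shiftedCoeff u w k) = conj (fockWeight k z') := by
    intro k z'
    rw [inner_shiftedCoeff hu]
    simp_rw [inner_shifted_self hu, mul_comm _ (conj z')]
    rw [iteratedDeriv_cexp_const_mul, fockWeight, map_div₀, map_pow, Complex.conj_ofReal]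
    simp
    ring
  have h2 : ∀ k l, inner ℂ (shiftedCoeff u w k) (shiftedCoeff u w l) = if k = l then 1 else 0 := by
    intro k l
    rw [inner_shiftedCoeff hu]
    have h3 : ∀ z, inner ℂ (shiftedCoeff u w k) (shifted u w z) =
        (Real.sqrt (k.factorial : ℝ) : ℂ)⁻¹ * z ^ k := by
      intro z
      rw [← inner_conj_symm, h1, Complex.conj_conj, fockWeight]
      ring
    simp_rw [h3]
    rw [iteratedDeriv_const_mul_field, iteratedDeriv_fun_pow_zero]
    split_ifs with h4 h5 h5
    · subst h4
      have h : ((Real.sqrt (l.factorial : ℝ) : ℝ) : ℂ) ^ 2 = l.factorial := by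
        exact_mod_cast congrArg Complex.ofReal (sqrt_factorial_sq l)
      have h0 : ((Real.sqrt (l.factorial : ℝ) : ℝ) : ℂ) ≠ 0 := by
        exact_mod_cast (sqrt_factorial_pos l).ne'
      rw [← h]
      field_simp
    · exact absurd h4.symm h5
    · exact absurd h5.symm h4
    · simp
  exact orthonormal_iff_ite.2 h2

/-- Cauchy's estimate for the coefficients of `shifted u w`, tested against a vector. -/
lemma norm_inner_shiftedCoeff_le (hu : Orthonormal ℂ u) (x : H) (w : ℂ) {k : ℕ} {ρ C : ℝ}
    (hρ : 0 < ρ) (hk : (k : ℝ) ≤ ρ ^ 2)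
    (hC : ∀ z, ‖z‖ = ρ → ‖inner ℂ x (shifted u w z)‖ ≤ C) :
    ‖inner ℂ x (shiftedCoeff u w k)‖ ≤ C := by
  have hdiff : Differentiable ℂ fun z => inner ℂ x (shifted u w z) :=
    (innerSL ℂ x).differentiable.comp (differentiable_shifted hu w)
  have hC0 : 0 ≤ C := (norm_nonneg _).trans (hC ρ (by simp [abs_of_pos hρ]))
  have h := Complex.norm_iteratedDeriv_le_of_forall_mem_sphere_norm_le k hρ
    hdiff.diffContOnCl (c := 0) fun z hz => hC z (by simpa using hz)
  have hs := sqrt_factorial_pos k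
  rw [inner_shiftedCoeff hu, norm_mul, norm_inv, Complex.norm_real, Real.norm_of_nonneg hs.le]
  calc _ ≤ (Real.sqrt (k.factorial : ℝ))⁻¹ * (k.factorial * C / ρ ^ k) := by gcongr
    _ = (Real.sqrt (k.factorial : ℝ) / ρ ^ k) * C := by
      nth_rewrite 2 [← sqrt_factorial_sq k]
      field_simp
    _ ≤ 1 * C := by
      gcongr
      exact (div_le_one (by positivity)).2 (sqrt_factorial_le_pow hρ.le hk)
    _ = C := one_mul C

lemma inner_shiftedCoeff_eq_zero (hu : Orthonormal ℂ u) {x : H} {w : ℂ}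
    (hx : ∀ z, inner ℂ x (shifted u w z) = 0) (k : ℕ) : inner ℂ x (shiftedCoeff u w k) = 0 := by
  rw [← norm_le_zero_iff]
  refine norm_inner_shiftedCoeff_le hu x w (ρ := k + 1) (by positivity) ?_ fun z _ => by simp [hx]
  nlinarith [(Nat.cast_nonneg k : (0 : ℝ) ≤ k)]

lemma inner_shifted_eq_zero (hu : Orthonormal ℂ u) {x : H} (hx : ∀ m, inner ℂ x (u m) = 0)
    (w z : ℂ) : inner ℂ x (shifted u w z) = 0 := by
  have h := (hasSum_coherent hu (w + z)).mapL (innerSL ℂ x)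
  simp only [innerSL_apply_apply, inner_smul_right, hx, mul_zero] at h
  rw [shifted, inner_smul_right, h.unique hasSum_zero, mul_zero]

lemma shiftedCoeff_mem (hu : Orthonormal ℂ u) {M : Submodule ℂ H} (hM : IsClosed (M : Set H))
    (hmem : ∀ m, u m ∈ M) (w : ℂ) (k : ℕ) : shiftedCoeff u w k ∈ M := by
  -- A closed subspace is its double orthogonal complement, so membership is tested against vectors
  -- orthogonal to all `u m`; these annihilate `shifted`, hence its Taylor coefficients.
  rw [← hM.submodule_topologicalClosure_eq, ← Submodule.orthogonal_orthogonal_eq_closure,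
    Submodule.mem_orthogonal]
  intro x hx
  refine inner_shiftedCoeff_eq_zero hu (inner_shifted_eq_zero hu (fun m => ?_) w) k
  exact Submodule.inner_left_of_mem_orthogonal (hmem m) hx

/-- Coefficients of shifts to distant points are almost orthogonal. -/
lemma norm_inner_shiftedCoeff_shiftedCoeff_le (hu : Orthonormal ℂ u) {w w' : ℂ} {ρ : ℝ}
    (hρ : 0 < ρ) (hd : 4 * ρ ≤ ‖w - w'‖) {k l : ℕ} (hk : (k : ℝ) ≤ ρ ^ 2) (hl : (l : ℝ) ≤ ρ ^ 2) :
    ‖inner ℂ (shiftedCoeff u w' l) (shiftedCoeff u w k)‖ ≤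
      Real.exp (ρ ^ 2 - ‖w - w'‖ ^ 2 / 8) := by
  refine norm_inner_shiftedCoeff_le hu _ w hρ hk fun z hz => ?_
  rw [norm_inner_symm]
  refine norm_inner_shiftedCoeff_le hu _ w' hρ hl fun z' hz' => ?_
  rw [norm_inner_symm, norm_inner_shifted hu, hz, hz']
  refine Real.exp_le_exp.2 ?_
  -- Moving both points by $\rho$ costs at most $2\rho$, which is at most half the distance;
  -- squaring and halving gives the $1/8$.
  have h1 : ‖w - w'‖ / 2 ≤ ‖w + z - w' - z'‖ := by
    have h2 : w - w' = (w + z - w' - z') + (z' - z) := by ring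
    have h3 := norm_add_le (w + z - w' - z') (z' - z)
    have h4 := norm_sub_le z' z
    rw [← h2] at h3
    linarith
  have h5 := pow_le_pow_left₀ (by positivity) h1 2
  linarith [h5, div_pow ‖w - w'‖ 2 2]

end

/-! ### Sums over separated points, independent rows, random power series. -/

section

/-- On the disc $|z|^2\le(|c|+1)^2\le4|c|^2$, and its area $\pi$ cancels the normalisation of the
density. -/
lemma exp_le_stdComplexGaussian_ball {c : ℂ} (hc : 2 ≤ ‖c‖) :
    ENNReal.ofReal (Real.exp (-(4 * ‖c‖ ^ 2))) ≤ stdComplexGaussian (Metric.ball c 1) := by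
  unfold stdComplexGaussian
  rw [withDensity_apply _ measurableSet_ball]
  calc ENNReal.ofReal (Real.exp (-(4 * ‖c‖ ^ 2)))
      = ∫⁻ _ in Metric.ball c 1,
          ENNReal.ofReal (Real.pi⁻¹ * Real.exp (-(4 * ‖c‖ ^ 2))) := by
        rw [setLIntegral_const, Complex.volume_ball, ENNReal.ofReal_one, one_pow, one_mul,
          ENNReal.ofReal_mul (by positivity), ENNReal.ofReal_inv_of_pos Real.pi_pos,
          mul_right_comm]
        have : ENNReal.ofReal Real.pi = (NNReal.pi : ℝ≥0∞) := by
          rw [← NNReal.coe_real_pi, ENNReal.ofReal_coe_nnreal]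
        rw [this, ENNReal.inv_mul_cancel (by simpa using NNReal.pi_ne_zero) ENNReal.coe_ne_top,
          one_mul]
    _ ≤ _ := by
        refine setLIntegral_mono' measurableSet_ball fun z hz => ENNReal.ofReal_le_ofReal ?_
        refine mul_le_mul_of_nonneg_left (Real.exp_le_exp.2 ?_) (by positivity)
        have h1 : ‖z‖ ≤ ‖c‖ + 1 := by
          have h2 := norm_add_le (z - c) c
          rw [sub_add_cancel] at h2
          have h3 : ‖z - c‖ < 1 := by simpa [dist_eq_norm] using hz
          linarith
        nlinarith [norm_nonneg z, norm_nonneg c]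

/-- A Gaussian sum over separated points, by comparison with the mass of disjoint discs. -/
lemma sum_exp_neg_sq_dist_le_one {I : Type*} {w : I → ℂ}
    (hsep : ∀ i j, i ≠ j → 16 ≤ ‖w i - w j‖) {i : I} {s : Finset I} (hi : i ∉ s) :
    ∑ j ∈ s, Real.exp (-(‖w i - w j‖ ^ 2 / 16)) ≤ 1 := by
  -- Scaling by $1/8$ turns separation 16 into 2, so the unit discs are disjoint, and
  -- $4|c_j|^2=|w_i-w_j|^2/16$ matches the summand.
  set c : I → ℂ := fun j => ((1 / 8 : ℝ) : ℂ) * (w i - w j) with hc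
  have hn : ∀ j, ‖c j‖ = ‖w i - w j‖ / 8 := fun j => by
    simp only [hc]
    rw [norm_mul, Complex.norm_real, Real.norm_of_nonneg (by norm_num)]
    ring
  have hball : ∀ j ∈ s, ENNReal.ofReal (Real.exp (-(‖w i - w j‖ ^ 2 / 16))) ≤
      stdComplexGaussian (Metric.ball (c j) 1) := by
    intro j hj
    have h16 := hsep i j (fun h => hi (h ▸ hj))
    refine le_trans (ENNReal.ofReal_le_ofReal (Real.exp_le_exp.2 ?_))
      (exp_le_stdComplexGaussian_ball (by rw [hn]; linarith))
    rw [hn]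
    linarith [div_pow ‖w i - w j‖ 8 2]
  have hdisj : (s : Set I).PairwiseDisjoint fun j => Metric.ball (c j) 1 := by
    intro j _ k _ hjk
    refine Metric.ball_disjoint_ball ?_
    have h16 := hsep k j hjk.symm
    have : c j - c k = ((1 / 8 : ℝ) : ℂ) * (w k - w j) := by simp only [hc]; ring
    rw [dist_eq_norm, this, norm_mul, Complex.norm_real, Real.norm_of_nonneg (by norm_num)]
    linarith
  rw [← ENNReal.ofReal_le_one, ENNReal.ofReal_sum_of_nonneg fun _ _ => (Real.exp_pos _).le]
  refine (Finset.sum_le_sum hball).trans ?_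
  rw [← measure_biUnion_finset hdisj fun _ _ => measurableSet_ball]
  exact prob_le_one

lemma countable_of_separated {I : Type*} {w : I → ℂ}
    (hsep : ∀ i j, i ≠ j → 16 ≤ ‖w i - w j‖) : Countable I := by
  refine Pairwise.countable_of_isOpen_disjoint (s := fun i => Metric.ball (w i) 1)
    (fun i j hij => Metric.ball_disjoint_ball ?_) (fun _ => Metric.isOpen_ball)
    (fun _ => Metric.nonempty_ball.2 one_pos)
  rw [dist_eq_norm]
  linarith [hsep i j hij]

variable {Ω : Type*} [MeasurableSpace Ω] {P : Measure Ω}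

/-- The rows of an independent array are independent. -/
lemma iIndepFun_curry [IsProbabilityMeasure P] {I K E : Type*} [MeasurableSpace E]
    {X : I × K → Ω → E} (hm : ∀ p, Measurable (X p)) (h : iIndepFun X P) :
    iIndepFun (fun i ω k => X (i, k) ω) P := by
  have hprob : ∀ i k, IsProbabilityMeasure (P.map (X (i, k))) := fun i k =>
    Measure.isProbabilityMeasure_map (hm _).aemeasurable
  have hrow : ∀ i, P.map (fun ω k => X (i, k) ω) =
      Measure.infinitePi fun k => P.map (X (i, k)) := fun i =>
    (h.precomp (g := fun k : K => (i, k)) (Prod.mk_right_injective i)).map_fun_eq_infinitePi_map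
      fun k => hm _
  rw [iIndepFun_iff_map_fun_eq_infinitePi_map fun i => measurable_pi_iff.2 fun k => hm _]
  simp_rw [hrow]
  rw [← Measure.infinitePi_map_curry (fun i k => P.map (X (i, k))),
    ← h.map_fun_eq_infinitePi_map hm, Measure.map_map (by fun_prop) (measurable_pi_iff.2 hm)]
  rfl

/-- The random entire function with given coefficients. -/
def fockSeries (a : ℕ → ℂ) (z : ℂ) : ℂ := ∑' k, a k * fockWeight k z

/-- Since `tsum` is 0 where the series diverges, this map is total on coefficient sequences;
composing with it preserves independence of the rows. -/
lemma measurable_fockSeries : Measurable fockSeries := by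
  refine measurable_pi_iff.2 fun z => ?_
  have hk : ∀ k, Measurable fun a : ℕ → ℂ => a k * fockWeight k z := fun k =>
    (measurable_pi_apply k).mul measurable_const
  exact Measurable.tsum hk

/-- Integer radii exhaust the plane and keep the summability hypothesis a countable family of almost
sure events. -/
lemma differentiable_of_hasSum_fockWeight {a : ℕ → ℂ} {f : ℂ → ℂ}
    (ha : ∀ n : ℕ, Summable fun k => ‖a k‖ * ((n : ℝ) ^ k / Real.sqrt (k.factorial : ℝ)))
    (hf : ∀ z, HasSum (fun k => a k * fockWeight k z) (f z)) : Differentiable ℂ f := by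
  intro z
  obtain ⟨n, hn⟩ := exists_nat_gt ‖z‖
  have h : DifferentiableOn ℂ (fun z => ∑' k, a k * fockWeight k z) (Metric.ball 0 n) := by
    refine Complex.differentiableOn_tsum_of_summable_norm (ha n) (fun k => ?_)
      Metric.isOpen_ball fun k y hy => ?_
    · exact ((differentiable_fockWeight k).const_mul _).differentiableOn
    · rw [norm_mul]
      gcongr
      exact norm_fockWeight_le_of_norm_le (mem_ball_zero_iff.1 hy).le k
  have hfun : (fun z => ∑' k, a k * fockWeight k z) = f := funext fun z => (hf z).tsum_eq
  rw [hfun] at h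
  exact h.differentiableAt (Metric.isOpen_ball.mem_nhds (by simpa using hn))

variable [IsProbabilityMeasure P]

lemma ae_summable_norm_mul {x : ℕ → Lp ℂ 2 P} {C : ℝ} (hx : ∀ k, ‖x k‖ ≤ C) {c : ℕ → ℝ}
    (hc0 : ∀ k, 0 ≤ c k) (hc : Summable c) : ∀ᵐ ω ∂P, Summable fun k => ‖x k ω‖ * c k := by
  have hs : Summable fun k => ‖(c k : ℂ) • x k‖ := by
    refine Summable.of_nonneg_of_le (fun _ => norm_nonneg _) (fun k => ?_) (hc.mul_right C)
    rw [norm_smul, Complex.norm_real, Real.norm_of_nonneg (hc0 k)]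
    exact mul_le_mul_of_nonneg_left (hx k) (hc0 k)
  filter_upwards [ae_summable_norm hs, ae_all_iff.2 fun k => Lp.coeFn_smul (c k : ℂ) (x k)]
    with ω h1 h2
  refine h1.congr fun k => ?_
  rw [h2, Pi.smul_apply, norm_smul, Complex.norm_real, Real.norm_of_nonneg (hc0 k), mul_comm]

/-- Coefficients bounded in `L²` define a random entire function. -/
lemma ae_summable_fockWeight {x : ℕ → Lp ℂ 2 P} {C : ℝ} (hx : ∀ k, ‖x k‖ ≤ C) :
    ∀ᵐ ω ∂P, ∀ n : ℕ, Summable fun k =>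
      ‖x k ω‖ * ((n : ℝ) ^ k / Real.sqrt (k.factorial : ℝ)) := by
  rw [ae_all_iff]
  exact fun n => ae_summable_norm_mul hx (fun k => by positivity)
    (summable_fockWeight (Nat.cast_nonneg n))

lemma summable_mul_fockWeight {a : ℕ → ℂ}
    (ha : ∀ n : ℕ, Summable fun k => ‖a k‖ * ((n : ℝ) ^ k / Real.sqrt (k.factorial : ℝ))) (z : ℂ) :
    Summable fun k => a k * fockWeight k z := by
  obtain ⟨n, hn⟩ := exists_nat_gt ‖z‖
  refine Summable.of_norm_bounded (ha n) fun k => ?_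
  rw [norm_mul]
  gcongr
  exact norm_fockWeight_le_of_norm_le hn.le k

end

/-! ### Passing between the random functions and their vectors. -/

section

variable {Ω J : Type*} [MeasurableSpace Ω] {P : Measure Ω} [IsProbabilityMeasure P]
  {ξ : ℕ → Ω → ℂ} {f : Ω → ℂ → ℂ}

lemma ae_eq_coherent (hξ : IsStdGaussianFamily P ξ)
    (hf : ∀ᵐ ω ∂P, ∀ z, HasSum (fun k => ξ k ω * fockWeight k z) (f ω z)) (y : ℂ) :
    (fun ω => f ω y) =ᵐ[P] ⇑(coherent hξ.vec y) := by
  have h1 := ae_hasSum_of_hasSum (summable_norm_fockWeight_smul hξ.orthonormal_vec y)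
    (hasSum_coherent hξ.orthonormal_vec y)
  filter_upwards [h1, hf, ae_all_iff.2 fun k => Lp.coeFn_smul (fockWeight k y) (hξ.vec k),
    ae_all_iff.2 hξ.coeFn_vec] with ω h1 h2 h3 h4
  refine (h2 y).unique ?_
  convert! h1 using 2 with k
  rw [h3, Pi.smul_apply, h4, smul_eq_mul, mul_comm]

lemma ae_shiftOp_eq_shifted (hξ : IsStdGaussianFamily P ξ)
    (hf : ∀ᵐ ω ∂P, ∀ z, HasSum (fun k => ξ k ω * fockWeight k z) (f ω z)) (w z : ℂ) :
    (fun ω => shiftOp w (f ω) z) =ᵐ[P] ⇑(shifted hξ.vec w z) := by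
  filter_upwards [ae_eq_coherent hξ hf (w + z), Lp.coeFn_smul
    (Complex.exp (-(z * conj w) - (‖w‖ ^ 2 / 2 : ℝ))) (coherent hξ.vec (w + z))] with ω h1 h2
  rw [shifted, h2, Pi.smul_apply, ← h1, shiftOp, smul_eq_mul, sub_eq_add_neg, Complex.exp_add]
  push_cast
  ring

lemma ae_differentiable (hξ : IsStdGaussianFamily P ξ)
    (hf : ∀ᵐ ω ∂P, ∀ z, HasSum (fun k => ξ k ω * fockWeight k z) (f ω z)) :
    ∀ᵐ ω ∂P, Differentiable ℂ (f ω) := by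
  filter_upwards [hf, ae_summable_fockWeight (fun k => (hξ.orthonormal_vec.1 k).le),
    ae_all_iff.2 hξ.coeFn_vec] with ω h1 h2 h3
  simp_rw [h3] at h2
  exact differentiable_of_hasSum_fockWeight h2 h1

/-- The shift of a Gaussian entire function is again expanded in the weights, simultaneously at
all points. -/
lemma ae_hasSum_shiftOp (hξ : IsStdGaussianFamily P ξ)
    (hf : ∀ᵐ ω ∂P, ∀ z, HasSum (fun k => ξ k ω * fockWeight k z) (f ω z)) (w : ℂ) :
    ∀ᵐ ω ∂P, ∀ z, HasSum (fun k => shiftedCoeff hξ.vec w k ω * fockWeight k z)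
      (shiftOp w (f ω) z) := by
  have hV := orthonormal_shiftedCoeff hξ.orthonormal_vec w
  have hpt : ∀ z, ∀ᵐ ω ∂P, HasSum (fun k => shiftedCoeff hξ.vec w k ω * fockWeight k z)
      (shiftOp w (f ω) z) := by
    intro z
    have hs : Summable fun k => ‖fockWeight k z • shiftedCoeff hξ.vec w k‖ := by
      simp_rw [norm_smul, hV.1, mul_one]
      exact summable_norm_fockWeight z
    filter_upwards [ae_hasSum_of_hasSum hs (hasSum_shifted hξ.orthonormal_vec w z),
      ae_shiftOp_eq_shifted hξ hf w z,
      ae_all_iff.2 fun k => Lp.coeFn_smul (fockWeight k z) (shiftedCoeff hξ.vec w k)]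
      with ω h1 h2 h3
    rw [h2]
    convert! h1 using 2 with k
    rw [h3, Pi.smul_apply, smul_eq_mul, mul_comm]
  -- The exceptional null set depends on `z`. Equality on a countable dense set, with continuity of
  -- both sides, gives a single null set for all `z`.
  filter_upwards [ae_all_iff.2 fun n => hpt (TopologicalSpace.denseSeq ℂ n),
    ae_differentiable hξ hf, ae_summable_fockWeight fun k => (hV.1 k).le] with ω h1 h2 h3
  have hsum := fun z => (summable_mul_fockWeight h3 z).hasSum
  have hcont := (differentiable_of_hasSum_fockWeight h3 hsum).continuous
  have hcont' : Continuous (shiftOp w (f ω)) := by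
    have := h2.continuous
    unfold shiftOp
    fun_prop
  have heq := Continuous.ext_on (TopologicalSpace.denseRange_denseSeq ℂ) hcont hcont' (by
    rintro _ ⟨n, rfl⟩
    exact (h1 n).tsum_eq)
  intro z
  rw [← heq]
  exact hsum z

lemma inner_vec_coherent_eq_zero (hξ : IsStdGaussianFamily P ξ)
    (hf : ∀ᵐ ω ∂P, ∀ z, HasSum (fun k => ξ k ω * fockWeight k z) (f ω z))
    {Ξ : J → Ω → ℂ} (h : IsStdGaussianFamily P Ξ) {l : J} (hl : IndepFun f (Ξ l) P) (y : ℂ) :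
    inner ℂ (h.vec l) (coherent hξ.vec y) = 0 := by
  have hae := ae_eq_coherent hξ hf y
  have hm : MemLp (fun ω => f ω y) 2 P := (memLp_congr_ae hae).2 (Lp.memLp _)
  have heq : hm.toLp _ = coherent hξ.vec y := Lp.ext (hm.coeFn_toLp.trans hae)
  rw [← heq]
  exact inner_toLp_eq_zero_of_indepFun (h.hasLaw l) hm
    (hl.symm.comp measurable_id (measurable_pi_apply y))

lemma inner_vec_shiftedCoeff_eq_zero (hξ : IsStdGaussianFamily P ξ)
    (hf : ∀ᵐ ω ∂P, ∀ z, HasSum (fun k => ξ k ω * fockWeight k z) (f ω z))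
    {Ξ : J → Ω → ℂ} (h : IsStdGaussianFamily P Ξ) {l : J} (hl : IndepFun f (Ξ l) P)
    (w : ℂ) (k : ℕ) : inner ℂ (h.vec l) (shiftedCoeff hξ.vec w k) = 0 :=
  inner_shiftedCoeff_eq_zero hξ.orthonormal_vec (x := h.vec l) (fun z => by
    rw [shifted, inner_smul_right, inner_vec_coherent_eq_zero hξ hf h hl, mul_zero]) k

variable {Ξ : J → Ω → ℂ} {η : ℕ → Lp ℂ 2 P}

lemma ae_hasSum_fockSeries (hη : Orthonormal ℂ η) :
    ∀ᵐ ω ∂P, ∀ z, HasSum (fun k => η k ω * fockWeight k z) (fockSeries (fun k => η k ω) z) := by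
  filter_upwards [ae_summable_fockWeight fun k => (hη.1 k).le] with ω hω z
  exact (summable_mul_fockWeight hω z).hasSum

lemma isGEF_fockSeries (h : IsStdGaussianFamily P Ξ) (hη : Orthonormal ℂ η)
    (hmem : ∀ k, η k ∈ h.space) : IsGEF P Ξ fun ω => fockSeries fun k => η k ω :=
  ⟨fun k => η k, fun k => h.inGaussianSpace_of_mem_space (hmem k), h.of_orthonormal hη hmem,
    ae_hasSum_fockSeries hη⟩

lemma ae_hasSum_shiftOp_sub (hξ : IsStdGaussianFamily P ξ)
    (hf : ∀ᵐ ω ∂P, ∀ z, HasSum (fun k => ξ k ω * fockWeight k z) (f ω z)) (w : ℂ)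
    (hη : Orthonormal ℂ η) :
    ∀ᵐ ω ∂P, ∀ z, HasSum (fun k => (shiftedCoeff hξ.vec w k - η k) ω * fockWeight k z)
      (shiftOp w (f ω) z - fockSeries (fun k => η k ω) z) := by
  filter_upwards [ae_hasSum_shiftOp hξ hf w, ae_hasSum_fockSeries hη,
    ae_all_iff.2 fun k => Lp.coeFn_sub (shiftedCoeff hξ.vec w k) (η k)] with ω h1 h2 h3 z
  convert! (h1 z).sub (h2 z) using 2 with k
  rw [h3, Pi.sub_apply, sub_mul]

lemma isRandomEntire_shiftOp_sub (hξ : IsStdGaussianFamily P ξ)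
    (hf : ∀ᵐ ω ∂P, ∀ z, HasSum (fun k => ξ k ω * fockWeight k z) (f ω z)) (w : ℂ)
    (hη : Orthonormal ℂ η) :
    IsRandomEntire P fun ω z => shiftOp w (f ω) z - fockSeries (fun k => η k ω) z := by
  have hV := orthonormal_shiftedCoeff hξ.orthonormal_vec w
  refine ⟨fun z => ?_, ?_⟩
  · refine AEMeasurable.sub ?_ ?_
    · exact (Lp.aestronglyMeasurable _).aemeasurable.congr (ae_shiftOp_eq_shifted hξ hf w z).symm
    · exact (((measurable_pi_apply z).comp measurable_fockSeries).comp
        (measurable_pi_iff.2 fun k => (Lp.stronglyMeasurable (η k)).measurable)).aemeasurable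
  · have hbound : ∀ k, ‖shiftedCoeff hξ.vec w k - η k‖ ≤ 1 + 1 := fun k =>
      (norm_sub_le _ _).trans_eq (by rw [hV.1, hη.1])
    filter_upwards [ae_hasSum_shiftOp_sub hξ hf w hη, ae_summable_fockWeight hbound] with ω h1 h2
    exact differentiable_of_hasSum_fockWeight h2 h1

lemma measure_exists_lt_norm_shiftOp_sub_le (h : IsStdGaussianFamily P Ξ)
    (hξ : IsStdGaussianFamily P ξ)
    (hf : ∀ᵐ ω ∂P, ∀ z, HasSum (fun k => ξ k ω * fockWeight k z) (f ω z)) (w : ℂ)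
    (hη : Orthonormal ℂ η) (hmem : ∀ k, shiftedCoeff hξ.vec w k - η k ∈ h.space)
    {r : ℝ} (hr : 0 < r) {δ : ℕ → ℝ} (hδ : ∀ k, 0 < δ k)
    (hb : ∀ k, ‖shiftedCoeff hξ.vec w k - η k‖ ≤ δ k) {D t : ℝ}
    (hD : ∀ n, ∑ k ∈ Finset.range n, δ k * (r ^ k / Real.sqrt (k.factorial : ℝ)) ≤ D)
    (ht : 0 ≤ t) :
    P {ω | ∃ z : ℂ, ‖z‖ ≤ r ∧ t * D < ‖shiftOp w (f ω) z - fockSeries (fun k => η k ω) z‖} ≤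
      ENNReal.ofReal (2 * Real.exp (-(1 / 2) * t ^ 2)) := by
  set c : ℕ → ℝ := fun k => r ^ k / Real.sqrt (k.factorial : ℝ) with hc
  have hc0 : ∀ k, 0 < c k := fun k => div_pos (pow_pos hr k) (sqrt_factorial_pos k)
  set x : ℕ → Lp ℂ 2 P := fun k => (c k : ℂ) • (shiftedCoeff hξ.vec w k - η k) with hx
  have hxd : ∀ k, ‖x k‖ ≤ δ k * c k := fun k => by
    simp only [hx]
    rw [norm_smul, Complex.norm_real, Real.norm_of_nonneg (hc0 k).le, mul_comm]
    exact mul_le_mul_of_nonneg_right (hb k) (hc0 k).le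
  refine le_trans (measure_mono_ae ?_) (h.measure_exists_lt_sum_norm_le
    (fun k => h.space.smul_mem _ (hmem k)) (fun k => mul_pos (hδ k) (hc0 k)) hxd hD ht)
  filter_upwards [ae_hasSum_shiftOp_sub hξ hf w hη,
    ae_all_iff.2 fun k => Lp.coeFn_smul (c k : ℂ) (shiftedCoeff hξ.vec w k - η k)] with ω h1 h2
  rintro ⟨z, hz, hlt⟩
  -- A strict inequality for the sum already holds at some partial sum, which is bounded termwise
  -- with the weights at radius `r`; the bound no longer involves `z`.
  obtain ⟨n, hn⟩ := ((h1 z).tendsto_sum_nat.norm.eventually (lt_mem_nhds hlt)).exists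
  refine ⟨n, hn.trans_le ((norm_sum_le _ _).trans (Finset.sum_le_sum fun k _ => ?_))⟩
  rw [h2, Pi.smul_apply, norm_smul, norm_mul, Complex.norm_real, Real.norm_of_nonneg (hc0 k).le,
    mul_comm]
  exact mul_le_mul_of_nonneg_right (norm_fockWeight_le_of_norm_le hz k) (norm_nonneg _)

end

/-! ### The truncated array: near orthogonality and the error budget. -/

section

variable {H I : Type*} [NormedAddCommGroup H] [InnerProductSpace ℂ H] {u : ℕ → H}

/-- The coefficients of index at most `B` of the shifts to the points `w i`, completed by the
vectors `v`. -/
def truncatedCoeff (u : ℕ → H) (w : I → ℂ) (v : I × ℕ → H) (B : ℝ) (p : I × ℕ) : H :=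
  if (p.2 : ℝ) ≤ B then shiftedCoeff u (w p.1) p.2 else v p

variable [CompleteSpace H] {w : I → ℂ} {v : I × ℕ → H} {ρ L : ℝ}

lemma norm_truncatedCoeff (hu : Orthonormal ℂ u) (hv : Orthonormal ℂ v) (B : ℝ) (p : I × ℕ) :
    ‖truncatedCoeff u w v B p‖ = 1 := by
  unfold truncatedCoeff
  split_ifs
  · exact (orthonormal_shiftedCoeff hu _).1 _
  · exact hv.1 p

/-- Only two retained coefficients at different points can fail to be orthogonal: at a common point
they are orthonormal, and the completing vectors are orthogonal to each other and to every shifted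
coefficient. -/
lemma norm_inner_truncatedCoeff_le [DecidableEq I] (hu : Orthonormal ℂ u) (hv : Orthonormal ℂ v)
    (hvu : ∀ p i k, inner ℂ (v p) (shiftedCoeff u (w i) k) = 0) (hρ : 0 < ρ) (hL : 4 * ρ ≤ L)
    (hsep : ∀ i j, i ≠ j → L ≤ ‖w i - w j‖) {p n : I × ℕ} (hpn : p ≠ n) :
    ‖inner ℂ (truncatedCoeff u w v (ρ ^ 2) p) (truncatedCoeff u w v (ρ ^ 2) n)‖ ≤
      if p.1 ≠ n.1 ∧ (p.2 : ℝ) ≤ ρ ^ 2 then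
        Real.exp (ρ ^ 2 - ‖w n.1 - w p.1‖ ^ 2 / 8) else 0 := by
  unfold truncatedCoeff
  by_cases hp : (p.2 : ℝ) ≤ ρ ^ 2 <;> by_cases hn : (n.2 : ℝ) ≤ ρ ^ 2
  · simp only [hp, hn, if_true, and_true]
    split_ifs with h
    · exact norm_inner_shiftedCoeff_shiftedCoeff_le hu hρ (hL.trans (hsep _ _ (Ne.symm h))) hn hp
    · rw [not_not] at h
      rw [h, (orthonormal_shiftedCoeff hu _).2 fun h2 => hpn (Prod.ext h h2), norm_zero]
  · simp only [hp, hn, if_true, if_false]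
    rw [← inner_conj_symm, hvu, map_zero, norm_zero]
    split_ifs <;> positivity
  · simp only [hp, hn, if_true, if_false, hvu, norm_zero, and_false, le_refl]
  · simp only [hp, hn, if_false, hv.2 hpn, norm_zero, and_false, le_refl]

lemma sum_norm_inner_truncatedCoeff_le (hu : Orthonormal ℂ u) (hv : Orthonormal ℂ v)
    (hvu : ∀ p i k, inner ℂ (v p) (shiftedCoeff u (w i) k) = 0) (hρ : 0 < ρ) (hL : 4 * ρ ≤ L)
    (hL16 : 16 ≤ L) (hsep : ∀ i j, i ≠ j → L ≤ ‖w i - w j‖) (n : I × ℕ) (s : Finset (I × ℕ))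
    (hn : n ∉ s) :
    ∑ p ∈ s, ‖inner ℂ (truncatedCoeff u w v (ρ ^ 2) p) (truncatedCoeff u w v (ρ ^ 2) n)‖ ≤
      Real.exp (2 * ρ ^ 2 - L ^ 2 / 16) := by
  classical
  set T := (s.image Prod.fst).erase n.1 with hT
  set R := Finset.range (⌊ρ ^ 2⌋₊ + 1) with hR
  have hcard : ((⌊ρ ^ 2⌋₊ + 1 : ℕ) : ℝ) ≤ Real.exp (ρ ^ 2) := by
    have h1 := Nat.floor_le (sq_nonneg ρ)
    have h2 := Real.add_one_le_exp (ρ ^ 2)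
    push_cast
    linarith
  calc _ ≤ ∑ p ∈ s, if p.1 ≠ n.1 ∧ (p.2 : ℝ) ≤ ρ ^ 2 then
        Real.exp (ρ ^ 2 - ‖w n.1 - w p.1‖ ^ 2 / 8) else 0 :=
        Finset.sum_le_sum fun p hp =>
          norm_inner_truncatedCoeff_le hu hv hvu hρ hL hsep (ne_of_mem_of_not_mem hp hn)
    _ ≤ ∑ p ∈ T ×ˢ R, Real.exp (ρ ^ 2 - ‖w n.1 - w p.1‖ ^ 2 / 8) := by
        rw [← Finset.sum_filter]
        refine Finset.sum_le_sum_of_subset_of_nonneg (fun p hp => ?_)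
          fun _ _ _ => (Real.exp_pos _).le
        obtain ⟨hps, hp1, hp2⟩ := Finset.mem_filter.1 hp
        refine Finset.mem_product.2 ⟨Finset.mem_erase.2
          ⟨hp1, Finset.mem_image_of_mem _ hps⟩, Finset.mem_range.2 ?_⟩
        exact Nat.lt_succ_of_le (Nat.le_floor hp2)
    _ = ((⌊ρ ^ 2⌋₊ + 1 : ℕ) : ℝ) * ∑ j ∈ T, Real.exp (ρ ^ 2 - ‖w n.1 - w j‖ ^ 2 / 8) := by
        rw [Finset.sum_product, Finset.mul_sum]
        refine Finset.sum_congr rfl fun j _ => ?_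
        simp only [Finset.sum_const, hR, Finset.card_range, nsmul_eq_mul]
    -- The exponent $d^2/8$ is split in half: $d^2/16\ge L^2/16$ supplies the smallness and the
    -- other $d^2/16$ makes the sum over points at most 1. The number of indices is absorbed in
    -- $e^{\rho^2}$.
    _ ≤ Real.exp (ρ ^ 2) * ∑ j ∈ T, Real.exp (ρ ^ 2 - L ^ 2 / 16) *
          Real.exp (-(‖w n.1 - w j‖ ^ 2 / 16)) := by
        refine mul_le_mul hcard (Finset.sum_le_sum fun j hj => ?_)
          (Finset.sum_nonneg fun _ _ => (Real.exp_pos _).le) (Real.exp_pos _).le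
        rw [← Real.exp_add]
        refine Real.exp_le_exp.2 ?_
        have h1 := hsep n.1 j (Finset.ne_of_mem_erase hj).symm
        have h2 := pow_le_pow_left₀ (by linarith) h1 2
        linarith
    _ ≤ Real.exp (ρ ^ 2) * (Real.exp (ρ ^ 2 - L ^ 2 / 16) * 1) := by
        rw [← Finset.mul_sum]
        refine mul_le_mul_of_nonneg_left (mul_le_mul_of_nonneg_left ?_ (Real.exp_pos _).le)
          (Real.exp_pos _).le
        exact sum_exp_neg_sq_dist_le_one (fun i j hij => hL16.trans (hsep i j hij))
          (Finset.notMem_erase _ _)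
    _ = _ := by
        rw [mul_one, ← Real.exp_add]
        congr 1
        ring

/-- The weighted sum of errors that are at most `ε` up to the index `B` and at most `2` past it. -/
lemma sum_error_mul_weight_le {r B ε : ℝ} (hr : 0 ≤ r) (hε : 0 ≤ ε) (n : ℕ) :
    ∑ k ∈ Finset.range n, (if (k : ℝ) ≤ B then ε else 2) *
        (r ^ k / Real.sqrt (k.factorial : ℝ)) ≤
      2 * ε * Real.exp (2 * r ^ 2) + 4 * Real.exp (15 * r ^ 2 - B) := by
  rw [← Finset.sum_filter_add_sum_filter_not (Finset.range n) (fun k : ℕ => (k : ℝ) ≤ B)]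
  have h1 : ∑ k ∈ Finset.range n with ((k : ℕ) : ℝ) ≤ B, (if (k : ℝ) ≤ B then ε else 2) *
      (r ^ k / Real.sqrt (k.factorial : ℝ)) ≤ ε * (2 * Real.exp (2 * r ^ 2)) := by
    refine le_trans (le_of_eq ?_) (mul_le_mul_of_nonneg_left (sum_fockWeight_le r
      ((Finset.range n).filter fun k : ℕ => (k : ℝ) ≤ B)) hε)
    rw [Finset.mul_sum]
    exact Finset.sum_congr rfl fun k hk => by rw [if_pos (Finset.mem_filter.1 hk).2]
  have h2 : ∑ k ∈ Finset.range n with ¬ ((k : ℕ) : ℝ) ≤ B, (if (k : ℝ) ≤ B then ε else 2) *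
      (r ^ k / Real.sqrt (k.factorial : ℝ)) ≤ 2 * (2 * Real.exp (15 * r ^ 2 - B)) := by
    refine le_trans (le_of_eq ?_) (mul_le_mul_of_nonneg_left (sum_fockWeight_tail_le hr
      ((Finset.range n).filter fun k : ℕ => ¬ (k : ℝ) ≤ B)
      fun k hk => not_le.1 (Finset.mem_filter.1 hk).2) zero_le_two)
    rw [Finset.mul_sum]
    exact Finset.sum_congr rfl fun k hk => by rw [if_neg (Finset.mem_filter.1 hk).2]
  linarith

/-- The 6 outweighs the growth $e^{2r^2}$ and the 18 outweighs $e^{15r^2}$, each leaving at least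
$e^{-3r^2}\le e^{-3}$. The prefactors $8+4=12$ are then absorbed by $e^3\ge12$. -/
lemma error_sum_le {N r : ℝ} (hr : 1 < r) (n : ℕ) :
    ∑ k ∈ Finset.range n, (if (k : ℝ) ≤ (18 + 3 / 2 * N) * r ^ 2 then
        4 * Real.exp (-((3 / 2 * N + 6) * r ^ 2)) else 2) *
        (r ^ k / Real.sqrt (k.factorial : ℝ)) ≤ Real.exp (-(3 / 2 * N) * r ^ 2) := by
  refine (sum_error_mul_weight_le (by linarith) (by positivity) n).trans ?_
  have hr2 : 1 ≤ r ^ 2 := by nlinarith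
  have h1 : Real.exp (-((3 / 2 * N + 6) * r ^ 2)) * Real.exp (2 * r ^ 2) ≤
      Real.exp (-(3 / 2 * N) * r ^ 2) * Real.exp (-3) := by
    rw [← Real.exp_add, ← Real.exp_add]
    exact Real.exp_le_exp.2 (by nlinarith)
  have h2 : Real.exp (15 * r ^ 2 - (18 + 3 / 2 * N) * r ^ 2) ≤
      Real.exp (-(3 / 2 * N) * r ^ 2) * Real.exp (-3) := by
    rw [← Real.exp_add]
    exact Real.exp_le_exp.2 (by nlinarith)
  have h3 : Real.exp (-3) ≤ 1 / 12 := by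
    rw [Real.exp_neg, one_div]
    refine inv_anti₀ (by norm_num) ?_
    have h4 : Real.exp 3 = Real.exp 1 ^ 3 := by rw [← Real.exp_nat_mul]; norm_num
    have h5 := Real.exp_one_gt_d9
    calc (12 : ℝ) ≤ 2.7 ^ 3 := by norm_num
      _ ≤ Real.exp 1 ^ 3 := pow_le_pow_left₀ (by norm_num) (by linarith) 3
      _ = _ := h4.symm
  have h4 := mul_le_mul_of_nonneg_left h3 (Real.exp_pos (-(3 / 2 * N) * r ^ 2)).le
  linarith

end
end GaussianEntire

end

/-! ### Choice of constants and assembly. -/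

open GaussianEntire in
theorem theorem3p2 (N : ℝ) (hN : 0 < N) :
    ∃ A : ℝ, 0 < A ∧
      -- the probability space and the big family of independent standard Gaussians on it
      ∀ (Ω : Type*) [MeasurableSpace Ω] (P : Measure Ω) [IsProbabilityMeasure P]
        (J : Type*) (Ξ : J → Ω → ℂ),
        GaussianEntire.IsStdGaussianFamily P Ξ →
      -- the G.E.F.; infinitely many members of the family are independent of it
      ∀ f : Ω → ℂ → ℂ, GaussianEntire.IsGEF P Ξ f →
        {j : J | IndepFun f (Ξ j) P}.Infinite →
      ∀ r : ℝ, 1 < r →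
      ∀ (I : Type*) (w : I → ℂ), (∀ i j, i ≠ j → A * r ≤ ‖w i - w j‖) →
      ∃ F h : I → Ω → ℂ → ℂ,
        (∀ j ω z, GaussianEntire.shiftOp (w j) (f ω) z = F j ω z + h j ω z) ∧
        (∀ j, GaussianEntire.IsGEF P Ξ (F j)) ∧
        iIndepFun F P ∧
        (∀ j, GaussianEntire.IsRandomEntire P (h j)) ∧
        ∀ j, P {ω | ∃ z : ℂ, ‖z‖ ≤ r ∧ Real.exp (-N * r ^ 2) < ‖h j ω z‖} ≤
          ENNReal.ofReal (2 * Real.exp (-(1 / 2) * Real.exp (N * r ^ 2))) := by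
  have hA2 : 0 < 16 * (2 * (18 + 3 / 2 * N) + 3 / 2 * N + 6) := by positivity
  -- This `A` is chosen so that $2\rho^2-L^2/16=-(\tfrac32N+6)r^2$ with $L=Ar$ and
  -- $\rho^2=(18+\tfrac32N)r^2$.
  refine ⟨Real.sqrt (16 * (2 * (18 + 3 / 2 * N) + 3 / 2 * N + 6)), Real.sqrt_pos.2 hA2, ?_⟩
  intro Ω _ P _ J Ξ h f hf hinf r hr I w hsep
  obtain ⟨ξ, hξmem, hξ, hfsum⟩ := hf
  set L := Real.sqrt (16 * (2 * (18 + 3 / 2 * N) + 3 / 2 * N + 6)) * r with hLdef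
  set ρ := Real.sqrt (18 + 3 / 2 * N) * r with hρdef
  have hr0 : 0 < r := by linarith
  have hr2 : 1 ≤ r ^ 2 := by nlinarith
  have hρ : 0 < ρ := by positivity
  have hρ2 : ρ ^ 2 = (18 + 3 / 2 * N) * r ^ 2 := by
    rw [hρdef, mul_pow, Real.sq_sqrt (by positivity)]
  have hL0 : 0 < L := by positivity
  have hL2 : L ^ 2 = 16 * (2 * (18 + 3 / 2 * N) + 3 / 2 * N + 6) * r ^ 2 := by
    rw [hLdef, mul_pow, Real.sq_sqrt hA2.le]
  have hL : 4 * ρ ≤ L := by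
    refine le_of_sq_le_sq ?_ hL0.le
    rw [mul_pow, hρ2, hL2]
    nlinarith
  have hL16 : 16 ≤ L := by
    refine le_of_sq_le_sq ?_ hL0.le
    rw [hL2]
    nlinarith
  -- With `I` empty, `I × ℕ` is not infinite and has no enumeration for Gram–Schmidt.
  rcases isEmpty_or_nonempty I with hI | hI
  · exact ⟨fun i => isEmptyElim i, fun i => isEmptyElim i, fun i => isEmptyElim i,
      fun i => isEmptyElim i, iIndepFun.of_subsingleton, fun i => isEmptyElim i,
      fun i => isEmptyElim i⟩
  have hcount : Countable I :=
    countable_of_separated (w := w) fun i j hij => hL16.trans (hsep i j hij)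
  obtain ⟨hden⟩ := nonempty_denumerable (I × ℕ)
  set e : I × ℕ ≃ ℕ := Denumerable.eqv (I × ℕ)
  -- A different generator independent of `f` is reserved for each pair, so the completing vectors
  -- are orthonormal across all rows.
  set b : I × ℕ → J := fun p => hinf.natEmbedding _ (e p) with hb
  have hbinj : Function.Injective b := fun p q hpq =>
    e.injective ((hinf.natEmbedding _).injective (Subtype.ext hpq))
  have hbind : ∀ p, IndepFun f (Ξ (b p)) P := fun p => (hinf.natEmbedding _ (e p)).2
  have hu := hξ.orthonormal_vec
  have humem : ∀ m, hξ.vec m ∈ h.space := fun m => (h.exists_toLp_mem_space (hξmem m)).2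
  have hVmem : ∀ i k, shiftedCoeff hξ.vec (w i) k ∈ h.space := fun i k =>
    shiftedCoeff_mem hu h.isClosed_space humem (w i) k
  have hv : Orthonormal ℂ fun p => h.vec (b p) := h.orthonormal_vec.comp b hbinj
  have hσ : Real.exp (2 * ρ ^ 2 - L ^ 2 / 16) = Real.exp (-((3 / 2 * N + 6) * r ^ 2)) := by
    congr 1
    rw [hρ2, hL2]
    ring
  have hσ2 : Real.exp (2 * ρ ^ 2 - L ^ 2 / 16) ≤ 1 / 2 := by
    rw [hσ, Real.exp_neg, one_div]
    refine inv_anti₀ (by norm_num) ?_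
    nlinarith [Real.add_one_le_exp ((3 / 2 * N + 6) * r ^ 2)]
  obtain ⟨η, hη, hηspan, hηnear⟩ := exists_orthonormal_near e
    (ζ := truncatedCoeff hξ.vec w (fun p => h.vec (b p)) (ρ ^ 2))
    (norm_truncatedCoeff hu hv _) hσ2
    (sum_norm_inner_truncatedCoeff_le hu hv
      (fun p i k => inner_vec_shiftedCoeff_eq_zero hξ hfsum h (hbind p) (w i) k) hρ hL hL16 hsep)
  have hηmem : ∀ p, η p ∈ h.space := by
    refine fun p => Submodule.span_le.2 ?_ (hηspan p)
    rintro _ ⟨q, rfl⟩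
    unfold truncatedCoeff
    split_ifs
    · exact hVmem _ _
    · exact h.vec_mem_space _
  have hηi : ∀ i, Orthonormal ℂ fun k => η (i, k) := fun i =>
    hη.comp (fun k => (i, k)) (Prod.mk_right_injective i)
  have hηm : ∀ p, Measurable (η p) := fun p => (Lp.stronglyMeasurable (η p)).measurable
  -- Taking `h` to be the difference makes the decomposition hold at every `ω`, including the null
  -- sets where the series diverge.
  refine ⟨fun i ω => fockSeries fun k => η (i, k) ω,
    fun i ω z => shiftOp (w i) (f ω) z - fockSeries (fun k => η (i, k) ω) z,
    fun i ω z => by ring, fun i => isGEF_fockSeries h (hηi i) fun k => hηmem _, ?_,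
    fun i => isRandomEntire_shiftOp_sub hξ hfsum (w i) (hηi i), fun i => ?_⟩
  · exact (iIndepFun_curry hηm (h.of_orthonormal hη hηmem).indep).comp
      (fun _ => fockSeries) fun _ => measurable_fockSeries
  · have hV := orthonormal_shiftedCoeff hu (w i)
    -- With $D=e^{-3Nr^2/2}$ and $t=e^{Nr^2/2}$ one has $tD=e^{-Nr^2}$ and $t^2=e^{Nr^2}$; this
    -- explains the $\tfrac32N$ in the constants.
    have key := measure_exists_lt_norm_shiftOp_sub_le h hξ hfsum (w i) (hηi i)
      (fun k => h.space.sub_mem (hVmem i k) (hηmem (i, k))) hr0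
      (δ := fun k => if (k : ℝ) ≤ (18 + 3 / 2 * N) * r ^ 2 then
        4 * Real.exp (-((3 / 2 * N + 6) * r ^ 2)) else 2)
      (fun k => by split_ifs <;> positivity) (fun k => ?_)
      (error_sum_le hr) (Real.exp_pos (N * r ^ 2 / 2)).le
    · have h1 : Real.exp (N * r ^ 2 / 2) * Real.exp (-(3 / 2 * N) * r ^ 2) =
          Real.exp (-N * r ^ 2) := by
        rw [← Real.exp_add]
        congr 1
        ring
      have h2 : Real.exp (N * r ^ 2 / 2) ^ 2 = Real.exp (N * r ^ 2) := by
        rw [← Real.exp_nat_mul]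
        congr 1
        push_cast
        ring
      rwa [h1, h2] at key
    · split_ifs with hk
      · have := hηnear (i, k)
        rwa [truncatedCoeff, if_pos (by rw [hρ2]; exact hk), hσ] at this
      · exact (norm_sub_le _ _).trans_eq (by rw [hV.1, (hηi i).1]; norm_num)
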